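/- Let $X_1,\dots,X_n$ be iid with distribution $F$ on $[0,\infty)$, and let $\xi_1,\dots,\xi_n$ be iid Bernoulli random variables with success probability $p$, independent of the $X_t$. For $\theta\ge 0$ and $p\in[0,1]$ let $\tau_p(\theta)$ be the randomized single threshold rule $$\tau_p(\theta)=\min\{1\le t\le n-1:\ X_t>\theta,\ \text{or}\ X_t=\theta \text{ and } \xi_t=1\},$$ with $\tau_p(\theta)=n$ if there is no such $t$, and let $\mathscr T_{\rm s,r}=\{\tau_p(\theta):\theta\ge0,\ p\in[0,1]\}$. Put $V_n(\tau;F)=\mathbb E X_\tau$ and $M_n(F)=\mathbb E\max_{1\le t\le n}X_t$. Let $$\mathcal A_n^*(\mathscr T_{\rm s,r};\mathcal F_{[0,1]})=\sup_{F\in\mathcal F_{[0,1]}}\ \inf_{\tau\in\mathscr T_{\rm s,r}}\{M_n(F)-V_n(\tau;F)\},\qquad \mathcal R_n^*(\mathscr T_{\rm s,r};\mathcal F_{[0,\infty)})=\inf_{F\in\mathcal F_{[0,\infty)}}\ \sup_{\tau\in\mathscr T_{\rm s,r}}\frac{V_n(\tau;F)}{M_n(F)},$$ where $\mathcal F_{[0,1]}$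 is the class of all distributions on $[0,1]$, and $\mathcal F_{[0,\infty)}$ is the class of all distributions on $[0,\infty)$ that have finite mean and are not concentrated at $0$. For $x,y\in(0,1)$ define $$R(x,y)=\begin{cases}\dfrac{1-x^{n-1}y}{1-y^n}, & x>y,\\[2mm] \dfrac{1-y}{1-y^n}\,\dfrac{1-x^n}{1-x}, & x<y,\\[2mm] 1,& x=y,\end{cases}\qquad A(x,y)=\begin{cases} y\,(x^{n-1}-y^{n-1}), & x>y,\\[1mm] (1-y)\sum_{k=1}^{n-1}(y^k-x^k), & x\le y,\end{cases}$$ and for an integer $N\ge2$ let $R_N=\big(R(\tfrac iN,\tfrac jN)\big)_{i,j=1}^{N-1}$ and $A_N=\big(A(\tfrac iN,\tfrac jN)\big)_{i,j=1}^{N-1}$. With $\lambda,\mu$ ranging over the probability vectors in $\mathbb R^{N-1}$, put $$\mathcal R_{n,N}^*=\min_\mu\max_\lambda \lambda^T R_N\mu,\qquad \mathcal A_{n,N}^*=\max_\mu\min_\lambda \lambda^T A_N\mu .$$ Then, for every integer $N\ge 2$: (i) for every $n\ge2$, $$\big|\mathcal A_n^*(\mathscr T_{\rm s,r};\mathcal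 F_{[0,1]})-\mathcal A_{n,N}^*\big|\le\frac{n-1}{2N};$$ (ii) for every $n\ge4$, $$\big|\mathcal R_n^*(\mathscr T_{\rm s,r};\mathcal F_{[0,\infty)})-\mathcal R_{n,N}^*\big|\le\frac{n-1}{2N\big[(1-e^{-1})^2-\frac1{n-1}\big]}.$$ -/

import Mathlib

open MeasureTheory ProbabilityTheory
open scoped NNReal unitInterval Matrix

namespace Prophet

noncomputable section

/-! ## Single threshold rules for iid observations -/

/-- A randomized single threshold rule `τ_p(θ)`: a threshold `θ ≥ 0` and an acceptance probability
`p ∈ [0,1]` that is used when an observation equals the threshold. The type is the class of all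
such rules. -/
structure ThresholdRule where
  /-- the threshold -/
  θ : ℝ≥0
  /-- the success probability of the coins -/
  p : I

/-- The stopping time `min {1 ≤ t ≤ n - 1 : X_t > θ or (X_t = θ and ξ_t = 1)}`, and `n` when there
is no such `t`. The observations `X_1, …, X_n` are `x 0, …, x (n - 1)`, and `ξ i = true` means that
the coin tossed with observation `i` shows success. -/
def stoppingTime (n : ℕ) (θ : ℝ≥0) (x : Fin n → ℝ) (ξ : Fin n → Bool) : ℕ :=
  sInf ({t : ℕ | ∃ i : Fin n, (i : ℕ) + 1 = t ∧ t ≤ n - 1 ∧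
    ((θ : ℝ) < x i ∨ (x i = θ ∧ ξ i = true))} ∪ {n})

/-- The stopped value `X_τ = ∑ₜ X_t 1{τ = t}`. -/
def stoppedObservation (n : ℕ) (θ : ℝ≥0) (x : Fin n → ℝ) (ξ : Fin n → Bool) : ℝ :=
  ∑ i : Fin n, if stoppingTime n θ x ξ = (i : ℕ) + 1 then x i else 0

/-- The joint law of the observations and the coins: `X_1, …, X_n` iid with distribution `F`, and,
independently of them, `ξ_1, …, ξ_n` iid Bernoulli with success probability `p`. -/
def sampleLaw (n : ℕ) (F : ProbabilityMeasure ℝ) (p : I) :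
    Measure ((Fin n → ℝ) × (Fin n → Bool)) :=
  (Measure.pi fun _ : Fin n => (F : Measure ℝ)).prod
    (Measure.pi fun _ : Fin n => bernoulliMeasure true false p)

/-- The expected reward `V_n(τ; F) = 𝔼 X_τ` of the rule `τ`. -/
def reward (n : ℕ) (τ : ThresholdRule) (F : ProbabilityMeasure ℝ) : ℝ :=
  ∫ ω, stoppedObservation n τ.θ ω.1 ω.2 ∂(sampleLaw n F τ.p)

/-- The performance of the prophet, `M_n(F) = 𝔼 max (X_1, …, X_n)`. -/
def prophetValue (n : ℕ) (F : ProbabilityMeasure ℝ) : ℝ :=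
  ∫ x : Fin n → ℝ, (⨆ i, x i) ∂(Measure.pi fun _ : Fin n => (F : Measure ℝ))

/-- The competitive ratio of `τ` under `F`. -/
def competitiveRatio (n : ℕ) (τ : ThresholdRule) (F : ProbabilityMeasure ℝ) : ℝ :=
  reward n τ F / prophetValue n F

/-- The regret of `τ` under `F`. -/
def regret (n : ℕ) (τ : ThresholdRule) (F : ProbabilityMeasure ℝ) : ℝ :=
  prophetValue n F - reward n τ F

/-- The worst-case competitive ratio of the optimal single threshold rule over the class `C`:
the sharp constant in the ratio-type prophet inequality. -/
def worstCaseRatio (n : ℕ) (C : Set (ProbabilityMeasure ℝ)) : ℝ :=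
  ⨅ F : C, ⨆ τ : ThresholdRule, competitiveRatio n τ F

/-- The worst-case regret of the optimal single threshold rule over the class `C`:
the sharp constant in the difference-type prophet inequality. -/
def worstCaseRegret (n : ℕ) (C : Set (ProbabilityMeasure ℝ)) : ℝ :=
  ⨆ F : C, ⨅ τ : ThresholdRule, regret n τ F

/-- All distributions on `[0,1]`. -/
def distUnitInterval : Set (ProbabilityMeasure ℝ) :=
  {F | ∀ᵐ x ∂(F : Measure ℝ), x ∈ Set.Icc (0 : ℝ) 1}

/-- All distributions on `[0,∞)` for which the competitive ratio makes sense: the mean is finite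
and the distribution is not concentrated at `0`. -/
def distNonneg : Set (ProbabilityMeasure ℝ) :=
  {F | (∀ᵐ x ∂(F : Measure ℝ), 0 ≤ x) ∧ Integrable (fun x : ℝ => x) (F : Measure ℝ) ∧
    ¬ ∀ᵐ x ∂(F : Measure ℝ), x = 0}

/-! ## The matrix games -/

/-- The pay-off kernel of the ratio game. -/
def kernelR (n : ℕ) (x y : ℝ) : ℝ :=
  if y < x then (1 - x ^ (n - 1) * y) / (1 - y ^ n)
  else if x < y then (1 - y) / (1 - y ^ n) * ((1 - x ^ n) / (1 - x))
  else 1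

/-- The pay-off kernel of the regret game. -/
def kernelA (n : ℕ) (x y : ℝ) : ℝ :=
  if y < x then y * (x ^ (n - 1) - y ^ (n - 1))
  else (1 - y) * ∑ k ∈ Finset.Icc 1 (n - 1), (y ^ k - x ^ k)

/-- The grid point `i / N`, `1 ≤ i ≤ N - 1` (the index of `Fin (N - 1)` is shifted by one). -/
def gridPoint (N : ℕ) (i : Fin (N - 1)) : ℝ := ((i : ℕ) + 1 : ℝ) / N

/-- The matrix `R_N` with entries `R(i/N, j/N)`, `1 ≤ i, j ≤ N - 1`. -/
def matrixR (n N : ℕ) : Matrix (Fin (N - 1)) (Fin (N - 1)) ℝ :=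
  Matrix.of fun i j => kernelR n (gridPoint N i) (gridPoint N j)

/-- The matrix `A_N` with entries `A(i/N, j/N)`, `1 ≤ i, j ≤ N - 1`. -/
def matrixA (n N : ℕ) : Matrix (Fin (N - 1)) (Fin (N - 1)) ℝ :=
  Matrix.of fun i j => kernelA n (gridPoint N i) (gridPoint N j)

/-- The value `min_m max_l lᵀ R_N m` over probability vectors `l` and `m`. -/
def matrixValueR (n N : ℕ) : ℝ :=
  ⨅ m : stdSimplex ℝ (Fin (N - 1)), ⨆ l : stdSimplex ℝ (Fin (N - 1)),
    (l : Fin (N - 1) → ℝ) ⬝ᵥ (matrixR n N *ᵥ (m : Fin (N - 1) → ℝ))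

/-- The value `max_m min_l lᵀ A_N m` over probability vectors `l` and `m`. -/
def matrixValueA (n N : ℕ) : ℝ :=
  ⨆ m : stdSimplex ℝ (Fin (N - 1)), ⨅ l : stdSimplex ℝ (Fin (N - 1)),
    (l : Fin (N - 1) → ℝ) ⬝ᵥ (matrixA n N *ᵥ (m : Fin (N - 1) → ℝ))

end

end Prophet

/-! Write n = m + 1. A rule affects its expected reward only through the probability x that it
rejects a single observation. By tail integration the reward is the integral over s > 0 of a kernel
in (x, F(s)), where F also denotes the distribution function, and the prophet's value is the
integral of 1 - F(s)^n (`reward_eq`, `prophetValue_eq`). Subtracting the two integrands gives A(x,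
F(s)); dividing them gives R(x, F(s)) (`kernelA_eq`, `kernelR_eq`).

Both problems are thus games on the unit square. The rule player picks x, and every x in (0,1) is
available (`exists_rejectProb_eq`). Nature picks a distribution of y = F(s): for the regret, s is
uniform on (0,1]; for the ratio, s has density (1 - F(s)^n)/M_n(F). Conversely, any weights on the
grid j/N are the times that some distribution function spends at these heights
(`exists_law_integral_comp_cdf`). The matrix games keep the order of optimization of the original
problems, so no minimax theorem is needed.

What remains is the cost of rounding one coordinate. A is Lipschitz in each variable with constant
m, so rounding to the nearest grid point costs at most m/(2N). R is not Lipschitz near the corner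
(1,1), but rounding down has a one-sided cost of at most m/N, which is all that either inequality
uses. This is stronger than the bound claimed in (ii) (`div_le_div_ratio_constant`). -/

namespace Prophet

/-! ## The pay-off kernels -/

section

/-- The geometric sum `1 + x + ⋯ + x ^ (n - 1)`. -/
noncomputable def geomSum (n : ℕ) (x : ℝ) : ℝ := ∑ k ∈ Finset.range n, x ^ k

/-- The expected reward, when a rule rejects an observation with probability `x`, under the
two-point law with atoms at `0` and `1` of which the first has mass `y`. -/
noncomputable def rewardKernel (n : ℕ) (x y : ℝ) : ℝ :=
  geomSum (n - 1) x * (1 - max x y) + x ^ (n - 1) * (1 - y)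

lemma pow_succ_sub_le {a b : ℝ} (ha : 0 ≤ a) (hab : a ≤ b) (k : ℕ) :
    b ^ (k + 1) - a ^ (k + 1) ≤ (k + 1) * b ^ k * (b - a) := by
  induction k with
  | zero => simp
  | succ k ih =>
    have h1 : a ^ (k + 1) ≤ b ^ (k + 1) := pow_le_pow_left₀ ha hab _
    have hb : 0 ≤ b := ha.trans hab
    have h2 := mul_le_mul_of_nonneg_left ih hb
    have h3 := mul_le_mul_of_nonneg_right h1 (sub_nonneg.2 hab)
    push_cast
    have e1 : b ^ (k + 1 + 1) - a ^ (k + 1 + 1)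
        = b * (b ^ (k + 1) - a ^ (k + 1)) + a ^ (k + 1) * (b - a) := by ring
    have e2 : ((k : ℝ) + 1 + 1) * b ^ (k + 1) * (b - a)
        = b * ((k + 1) * b ^ k * (b - a)) + b ^ (k + 1) * (b - a) := by ring
    linarith

lemma le_pow_succ_sub {a b : ℝ} (ha : 0 ≤ a) (hab : a ≤ b) (k : ℕ) :
    (k + 1) * a ^ k * (b - a) ≤ b ^ (k + 1) - a ^ (k + 1) := by
  induction k with
  | zero => simp
  | succ k ih =>
    have h1 : a ^ (k + 1) ≤ b ^ (k + 1) := pow_le_pow_left₀ ha hab _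
    have h2 := mul_le_mul_of_nonneg_left ih ha
    have h3 := mul_le_mul_of_nonneg_right h1 (sub_nonneg.2 hab)
    push_cast
    have e1 : b ^ (k + 1 + 1) - a ^ (k + 1 + 1)
        = a * (b ^ (k + 1) - a ^ (k + 1)) + b ^ (k + 1) * (b - a) := by ring
    have e2 : ((k : ℝ) + 1 + 1) * a ^ (k + 1) * (b - a)
        = a * ((k + 1) * a ^ k * (b - a)) + a ^ (k + 1) * (b - a) := by ring
    linarith

/-! ### Geometric sums -/

lemma geomSum_succ (n : ℕ) (x : ℝ) : geomSum (n + 1) x = geomSum n x + x ^ n :=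
  Finset.sum_range_succ _ _

lemma geomSum_mul (n : ℕ) (x : ℝ) : geomSum n x * (1 - x) = 1 - x ^ n := by
  have := geom_sum_mul x n
  unfold geomSum
  linarith

lemma geomSum_nonneg (n : ℕ) {x : ℝ} (hx : 0 ≤ x) : 0 ≤ geomSum n x :=
  Finset.sum_nonneg fun _ _ => pow_nonneg hx _

lemma one_le_geomSum_succ (n : ℕ) {x : ℝ} (hx : 0 ≤ x) : 1 ≤ geomSum (n + 1) x := by
  rw [geomSum, Finset.sum_range_succ', pow_zero]
  have := Finset.sum_nonneg (s := Finset.range n) fun k _ => pow_nonneg hx (k + 1)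
  linarith

lemma geomSum_mono (n : ℕ) {x y : ℝ} (hx : 0 ≤ x) (hxy : x ≤ y) : geomSum n x ≤ geomSum n y :=
  Finset.sum_le_sum fun _ _ => pow_le_pow_left₀ hx hxy _

lemma geomSum_le (n : ℕ) {x : ℝ} (hx : 0 ≤ x) (hx1 : x ≤ 1) : geomSum n x ≤ n := by
  have := geomSum_mono n hx hx1
  simpa [geomSum] using this

lemma geomSum_succ_sub_le (n : ℕ) {x y : ℝ} (hx : 0 ≤ x) (hxy : x ≤ y) :
    geomSum (n + 1) y - geomSum (n + 1) x ≤ n * (y - x) * geomSum n y := by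
  rw [geomSum, geomSum, Finset.sum_range_succ', Finset.sum_range_succ', geomSum, Finset.mul_sum]
  simp only [pow_zero, add_sub_add_right_eq_sub, ← Finset.sum_sub_distrib]
  refine Finset.sum_le_sum fun k hk => (pow_succ_sub_le hx hxy k).trans ?_
  have hk' : (k : ℝ) + 1 ≤ n := by exact_mod_cast Finset.mem_range.1 hk
  have : 0 ≤ y ^ k * (y - x) := mul_nonneg (pow_nonneg (hx.trans hxy) _) (sub_nonneg.2 hxy)
  nlinarith

lemma geomSum_succ_sub_le' (n : ℕ) {x y : ℝ} (hx : 0 ≤ x) (hxy : x ≤ y) :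
    geomSum (n + 1) y - geomSum (n + 1) x ≤ n * (y - x) * geomSum (n + 1) y := by
  refine (geomSum_succ_sub_le n hx hxy).trans (mul_le_mul_of_nonneg_left ?_
    (mul_nonneg n.cast_nonneg (sub_nonneg.2 hxy)))
  rw [geomSum_succ]
  linarith [pow_nonneg (hx.trans hxy) n]

/-! ### The reward kernel and the two pay-offs built from it -/

lemma rewardKernel_of_le (m : ℕ) {x y : ℝ} (h : y ≤ x) :
    rewardKernel (m + 1) x y = 1 - x ^ m * y := by
  rw [rewardKernel, max_eq_left h, add_tsub_cancel_right, geomSum_mul]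
  ring

lemma rewardKernel_of_ge (m : ℕ) {x y : ℝ} (h : x ≤ y) :
    rewardKernel (m + 1) x y = (1 - y) * geomSum (m + 1) x := by
  rw [rewardKernel, max_eq_right h, add_tsub_cancel_right, geomSum_succ]
  ring

lemma rewardKernel_nonneg (n : ℕ) {x y : ℝ} (hx : 0 ≤ x) (hx1 : x ≤ 1) (hy : y ≤ 1) :
    0 ≤ rewardKernel n x y :=
  add_nonneg (mul_nonneg (geomSum_nonneg _ hx) (sub_nonneg.2 (max_le hx1 hy)))
    (mul_nonneg (pow_nonneg hx _) (sub_nonneg.2 hy))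

/-- Pointwise form of the fact that no rule beats the prophet: 1 - y^(m+1) is the prophet's
integrand at a level s with F(s) = y. -/
lemma rewardKernel_le (m : ℕ) {x y : ℝ} (hx : 0 ≤ x) (hy0 : 0 ≤ y) (hy : y ≤ 1) :
    rewardKernel (m + 1) x y ≤ 1 - y ^ (m + 1) := by
  rcases le_total y x with h | h
  · rw [rewardKernel_of_le m h, pow_succ]
    nlinarith [pow_le_pow_left₀ hy0 h m]
  · rw [rewardKernel_of_ge m h, ← geomSum_mul, mul_comm]
    exact mul_le_mul_of_nonneg_right (geomSum_mono _ hx h) (sub_nonneg.2 hy)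

lemma kernelR_eq (m : ℕ) {x y : ℝ} (hx1 : x < 1) (hy0 : 0 ≤ y) (hy : y < 1) :
    kernelR (m + 1) x y = rewardKernel (m + 1) x y / (1 - y ^ (m + 1)) := by
  have hD : 1 - y ^ (m + 1) ≠ 0 := (sub_pos.2 (pow_lt_one₀ hy0 hy (by simp))).ne'
  rw [kernelR]
  split_ifs with h1 h2
  · rw [rewardKernel_of_le m h1.le, add_tsub_cancel_right]
  · have : 1 - x ≠ 0 := (sub_pos.2 hx1).ne'
    rw [rewardKernel_of_ge m h2.le, ← geomSum_mul (m + 1) x]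
    field_simp
  · have : x = y := le_antisymm (not_lt.1 h1) (not_lt.1 h2)
    subst this
    rw [rewardKernel_of_le m le_rfl, ← pow_succ, div_self hD]

lemma kernelA_eq (m : ℕ) (x y : ℝ) :
    kernelA (m + 1) x y = 1 - y ^ (m + 1) - rewardKernel (m + 1) x y := by
  rw [kernelA, add_tsub_cancel_right]
  split_ifs with h
  · rw [rewardKernel_of_le m h.le]
    ring
  · rw [rewardKernel_of_ge m (not_lt.1 h), ← geomSum_mul, Finset.sum_sub_distrib]
    have key : ∀ z : ℝ, ∑ k ∈ Finset.Icc 1 m, z ^ k = geomSum (m + 1) z - 1 := by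
      intro z
      rw [geomSum, Finset.range_eq_Ico, Finset.sum_eq_sum_Ico_succ_bot (by simp)]
      simp only [pow_zero, add_sub_cancel_left]
      rfl
    rw [key, key]
    ring

lemma kernelA_nonneg (m : ℕ) {x y : ℝ} (hx : 0 ≤ x) (hy0 : 0 ≤ y) (hy : y ≤ 1) :
    0 ≤ kernelA (m + 1) x y := by
  rw [kernelA_eq]
  linarith [rewardKernel_le m hx hy0 hy]

lemma kernelA_self (m : ℕ) (x : ℝ) : kernelA (m + 1) x x = 0 := by
  rw [kernelA_eq, rewardKernel_of_le m le_rfl]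
  ring

lemma kernelA_of_le (m : ℕ) {x y : ℝ} (h : y ≤ x) :
    kernelA (m + 1) x y = x ^ m * y - y ^ (m + 1) := by
  rw [kernelA_eq, rewardKernel_of_le m h]
  ring

lemma kernelA_of_ge (m : ℕ) {x y : ℝ} (h : x ≤ y) :
    kernelA (m + 1) x y = (1 - y) * (geomSum (m + 1) y - geomSum (m + 1) x) := by
  rw [kernelA_eq, rewardKernel_of_ge m h, ← geomSum_mul]
  ring

lemma kernelA_zero_right (m : ℕ) {x : ℝ} (hx : 0 ≤ x) : kernelA (m + 1) x 0 = 0 := by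
  simp [kernelA_of_le m hx]

lemma kernelA_one_right (m : ℕ) {x : ℝ} (hx : x ≤ 1) : kernelA (m + 1) x 1 = 0 := by
  simp [kernelA_of_ge m hx]

/-- The regret kernel increases in its first argument above the diagonal. -/
lemma kernelA_le_of_le (m : ℕ) {x x' y : ℝ} (hy : 0 ≤ y) (h : y ≤ x) (h' : x ≤ x') :
    kernelA (m + 1) x y ≤ kernelA (m + 1) x' y := by
  rw [kernelA_of_le m h, kernelA_of_le m (h.trans h')]
  gcongr
  exact hy.trans h

/-- The regret kernel decreases in its first argument below the diagonal. -/
lemma kernelA_le_of_ge (m : ℕ) {x x' y : ℝ} (hx : 0 ≤ x) (hy : y ≤ 1) (h : x ≤ x') (h' : x' ≤ y) :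
    kernelA (m + 1) x' y ≤ kernelA (m + 1) x y := by
  rw [kernelA_of_ge m h', kernelA_of_ge m (h.trans h')]
  exact mul_le_mul_of_nonneg_left (by linarith [geomSum_mono (m + 1) hx h]) (sub_nonneg.2 hy)

/-! ### Lipschitz bounds for the regret kernel -/

lemma kernelA_sub_le_of_le (m : ℕ) {x x' y : ℝ} (hy : 0 ≤ y) (h : y ≤ x) (h' : x ≤ x')
    (hx' : x' ≤ 1) : kernelA (m + 1) x' y - kernelA (m + 1) x y ≤ m * (x' - x) := by
  rw [kernelA_of_le m h, kernelA_of_le m (h.trans h')]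
  rcases m with _ | k
  · simp
  have h0 : 0 ≤ x := hy.trans h
  have h1 : x' ^ k ≤ 1 := pow_le_one₀ (h0.trans h') hx'
  have h2 : y ≤ 1 := h.trans (h'.trans hx')
  have h3 : x ^ (k + 1) ≤ x' ^ (k + 1) := pow_le_pow_left₀ h0 h' _
  calc _ = (x' ^ (k + 1) - x ^ (k + 1)) * y := by ring
    _ ≤ (x' ^ (k + 1) - x ^ (k + 1)) * 1 := mul_le_mul_of_nonneg_left h2 (sub_nonneg.2 h3)
    _ ≤ (k + 1) * x' ^ k * (x' - x) := by simpa using pow_succ_sub_le h0 h' k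
    _ ≤ (k + 1) * 1 * (x' - x) := by gcongr
    _ = _ := by push_cast; ring

/-- The increment of the geometric sum is at most m (x' - x) times `geomSum m x'`, and the factor 1
- y absorbs that sum because x' ≤ y. -/
lemma kernelA_sub_le_of_ge (m : ℕ) {x x' y : ℝ} (hx : 0 ≤ x) (hy : y ≤ 1) (h : x ≤ x')
    (h' : x' ≤ y) : kernelA (m + 1) x y - kernelA (m + 1) x' y ≤ m * (x' - x) := by
  rw [kernelA_of_ge m h', kernelA_of_ge m (h.trans h')]
  have h0 : 0 ≤ x' := hx.trans h
  have hc : 0 ≤ (m : ℝ) * (x' - x) := mul_nonneg m.cast_nonneg (sub_nonneg.2 h)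
  have h2 : (1 - y) * geomSum m x' ≤ 1 := by
    have := mul_le_mul_of_nonneg_right (geomSum_mono m h0 h') (sub_nonneg.2 hy)
    rw [geomSum_mul] at this
    linarith [pow_nonneg (h0.trans h') m]
  calc _ = (1 - y) * (geomSum (m + 1) x' - geomSum (m + 1) x) := by ring
    _ ≤ (1 - y) * (m * (x' - x) * geomSum m x') :=
        mul_le_mul_of_nonneg_left (geomSum_succ_sub_le m hx h) (sub_nonneg.2 hy)
    _ = m * (x' - x) * ((1 - y) * geomSum m x') := by ring
    _ ≤ m * (x' - x) * 1 := mul_le_mul_of_nonneg_left h2 hc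
    _ = _ := mul_one _

/-- If y separates x and x', the kernel vanishes at the diagonal point between them and is
nonnegative at x', so only the part of the path from y to x counts. -/
lemma kernelA_lipschitz_left (m : ℕ) {x x' y : ℝ} (hx : 0 ≤ x) (hx1 : x ≤ 1) (hx' : 0 ≤ x')
    (hy : 0 ≤ y) (hy1 : y ≤ 1) :
    kernelA (m + 1) x y ≤ kernelA (m + 1) x' y + m * |x - x'| := by
  have hm : (0 : ℝ) ≤ m := m.cast_nonneg
  rcases le_total x x' with h | h
  · rw [abs_sub_comm, abs_of_nonneg (sub_nonneg.2 h)]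
    have hc : 0 ≤ (m : ℝ) * (x' - x) := mul_nonneg hm (sub_nonneg.2 h)
    rcases le_total y x with h1 | h1
    · linarith [kernelA_le_of_le m hy h1 h]
    rcases le_total x' y with h2 | h2
    · linarith [kernelA_sub_le_of_ge m hx hy1 h h2]
    · have := kernelA_sub_le_of_ge m hx hy1 h1 le_rfl
      rw [kernelA_self] at this
      linarith [kernelA_nonneg m hx' hy hy1, mul_le_mul_of_nonneg_left h2 hm]
  · rw [abs_of_nonneg (sub_nonneg.2 h)]
    have hc : 0 ≤ (m : ℝ) * (x - x') := mul_nonneg hm (sub_nonneg.2 h)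
    rcases le_total y x' with h1 | h1
    · linarith [kernelA_sub_le_of_le m hy h1 h hx1]
    rcases le_total x y with h2 | h2
    · linarith [kernelA_le_of_ge m hx' hy1 h h2]
    · have := kernelA_sub_le_of_le m hy le_rfl h2 hx1
      rw [kernelA_self] at this
      linarith [kernelA_nonneg m hx' hy hy1, mul_le_mul_of_nonneg_left h1 hm]

/-- The slope in y is x^m - (m+1) y^m. It is at most 1, hence at most m, and at least -m because y^m
≤ x^m ≤ 1. -/
lemma kernelA_sub_right_of_le (m : ℕ) (hm : 1 ≤ m) {x y y' : ℝ} (hy : 0 ≤ y) (h : y ≤ y')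
    (h' : y' ≤ x) (hx : x ≤ 1) :
    |kernelA (m + 1) x y' - kernelA (m + 1) x y| ≤ m * (y' - y) := by
  rw [kernelA_of_le m h', kernelA_of_le m (h.trans h')]
  have hm' : (1 : ℝ) ≤ m := by exact_mod_cast hm
  have h0 : 0 ≤ y' - y := sub_nonneg.2 h
  have hy' : 0 ≤ y' := hy.trans h
  have h1 : x ^ m ≤ 1 := pow_le_one₀ (hy'.trans h') hx
  have h2 : y' ^ m ≤ x ^ m := pow_le_pow_left₀ hy' h' m
  have h3 := pow_succ_sub_le hy h m
  have h4 : y ^ (m + 1) ≤ y' ^ (m + 1) := pow_le_pow_left₀ hy h _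
  have h5 : ((m : ℝ) + 1) * y' ^ m ≤ m + x ^ m := by nlinarith
  have h6 := mul_le_mul_of_nonneg_right h5 h0
  have h7 := mul_le_mul_of_nonneg_right h1 h0
  have h8 := mul_le_mul_of_nonneg_right hm' h0
  rw [abs_le]
  constructor <;> linarith

/-- The slope in y is `geomSum (m + 1) x` - (m+1) y^m. The geometric sum lies between 1 and m + y^m,
so the slope lies between -m and m. -/
lemma kernelA_sub_right_of_ge (m : ℕ) {x y y' : ℝ} (hx : 0 ≤ x) (h : x ≤ y)
    (h' : y ≤ y') (hy : y' ≤ 1) :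
    |kernelA (m + 1) x y' - kernelA (m + 1) x y| ≤ m * (y' - y) := by
  rw [kernelA_eq, kernelA_eq, rewardKernel_of_ge m h, rewardKernel_of_ge m (h.trans h')]
  have h0 : 0 ≤ y' - y := sub_nonneg.2 h'
  have hy0 : 0 ≤ y := hx.trans h
  have hy0' : 0 ≤ y' := hy0.trans h'
  have h1 := le_pow_succ_sub hy0 h' m
  have h2 := pow_succ_sub_le hy0 h' m
  have h3 : y' ^ m ≤ 1 := pow_le_one₀ hy0' hy
  have h4 : geomSum (m + 1) x ≤ m + y ^ m := by
    refine (geomSum_mono _ hx h).trans ?_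
    rw [geomSum_succ]
    linarith [geomSum_le m hy0 (h'.trans hy)]
  have h5 := mul_le_mul_of_nonneg_right h4 h0
  have h6 := mul_le_mul_of_nonneg_right (one_le_geomSum_succ m hx) h0
  have h7 : ((m : ℝ) + 1) * y' ^ m * (y' - y) ≤ (m + 1) * (y' - y) := by
    refine mul_le_mul_of_nonneg_right ?_ h0
    exact mul_le_of_le_one_right (by positivity) h3
  have h8 : 0 ≤ (m : ℝ) * y ^ m * (y' - y) := by positivity
  rw [abs_le]
  constructor <;> linarith

lemma kernelA_lipschitz_right (m : ℕ) (hm : 1 ≤ m) {x y y' : ℝ} (hx : 0 ≤ x) (hx1 : x ≤ 1)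
    (hy : 0 ≤ y) (hy1 : y ≤ 1) (hy' : 0 ≤ y') (hy1' : y' ≤ 1) :
    |kernelA (m + 1) x y - kernelA (m + 1) x y'| ≤ m * |y - y'| := by
  wlog h : y' ≤ y generalizing y y'
  · rw [abs_sub_comm, abs_sub_comm y]
    exact this hy' hy1' hy hy1 (le_of_not_ge h)
  rw [abs_of_nonneg (sub_nonneg.2 h)]
  rcases le_total y x with h1 | h1
  · exact kernelA_sub_right_of_le m hm hy' h h1 hx1
  rcases le_total x y' with h2 | h2
  · exact kernelA_sub_right_of_ge m hx h2 h hy1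
  · have e1 := kernelA_sub_right_of_le m hm hy' h2 le_rfl hx1
    have e2 := kernelA_sub_right_of_ge m hx le_rfl h1 hy1
    have := abs_sub_le (kernelA (m + 1) x y) (kernelA (m + 1) x x) (kernelA (m + 1) x y')
    linarith

end

/-! ## Expected reward and expected maximum -/

section

/-- The pairs (observation, coin) that a rule with threshold `θ` accepts. -/
def acceptSet (θ : ℝ≥0) : Set (ℝ × Bool) := {z | (θ : ℝ) < z.1 ∨ (z.1 = θ ∧ z.2 = true)}

/-- The probability that the rule `τ` rejects a given observation. -/
noncomputable def rejectProb (τ : ThresholdRule) (F : ProbabilityMeasure ℝ) : ℝ :=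
  (F : Measure ℝ).real (Set.Iio (τ.θ : ℝ)) + (1 - τ.p) * (F : Measure ℝ).real {(τ.θ : ℝ)}

lemma measurableSet_acceptSet (θ : ℝ≥0) : MeasurableSet (acceptSet θ) := by
  unfold acceptSet
  refine (measurableSet_lt measurable_const measurable_fst).union
    ((measurableSet_eq_fun measurable_fst measurable_const).inter ?_)
  exact measurableSet_eq_fun measurable_snd measurable_const

/-- The last index needs no acceptance: a rule that has rejected everything before is forced to stop
there. -/
lemma stoppingTime_eq_iff (m : ℕ) (θ : ℝ≥0) (x : Fin (m + 1) → ℝ) (ξ : Fin (m + 1) → Bool)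
    (i : Fin (m + 1)) :
    stoppingTime (m + 1) θ x ξ = (i : ℕ) + 1 ↔
      (∀ j < i, (x j, ξ j) ∉ acceptSet θ) ∧ (i = Fin.last m ∨ (x i, ξ i) ∈ acceptSet θ) := by
  unfold stoppingTime
  set S : Set ℕ := {t : ℕ | ∃ i : Fin (m + 1), (i : ℕ) + 1 = t ∧ t ≤ m + 1 - 1 ∧
    ((θ : ℝ) < x i ∨ (x i = θ ∧ ξ i = true))} ∪ {m + 1} with hS
  have hmem : ∀ j : Fin (m + 1), (j : ℕ) + 1 ∈ S ↔
      j = Fin.last m ∨ (x j, ξ j) ∈ acceptSet θ := by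
    intro j
    simp only [hS, Set.mem_union, Set.mem_ofPred_eq, Set.mem_singleton_iff, acceptSet,
      add_tsub_cancel_right]
    constructor
    · rintro (⟨k, hk, -, h⟩ | h)
      · have : k = j := Fin.ext (by omega)
        exact Or.inr (this ▸ h)
      · exact Or.inl (Fin.ext (by simpa using h))
    · rintro (h | h)
      · exact Or.inr (by simp [h])
      -- An acceptance at the last index is excluded from the first set by t ≤ n - 1, but that time
      -- is the default value n anyway.
      · by_cases hj : (j : ℕ) = m
        · exact Or.inr (by omega)
        · exact Or.inl ⟨j, rfl, by have := j.2; omega, h⟩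
  have hne : S.Nonempty := ⟨m + 1, Or.inr rfl⟩
  constructor
  · intro h
    refine ⟨fun j hj hacc => ?_, (hmem i).1 (h ▸ Nat.sInf_mem hne)⟩
    have h1 : (j : ℕ) + 1 ∉ S := Nat.notMem_of_lt_sInf (by have := Fin.lt_def.1 hj; omega)
    exact h1 ((hmem j).2 (Or.inr hacc))
  · rintro ⟨h1, h2⟩
    refine IsLeast.csInf_eq ⟨(hmem i).2 h2, fun t ht => ?_⟩
    by_contra hlt
    have ht0 : t ≠ 0 := by
      rintro rfl
      rcases ht with ⟨k, hk, -⟩ | h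
      · omega
      · simp at h
    have hti : t - 1 < i := by omega
    have hj := (hmem ⟨t - 1, hti.trans i.2⟩).1
      (by simpa [Nat.sub_add_cancel (Nat.pos_of_ne_zero ht0)] using ht)
    rcases hj with hj | hj
    · have := congrArg Fin.val hj
      have := i.2
      simp at *
      omega
    · exact h1 _ (Fin.lt_def.2 hti) hj

/-- The factor with index `j` of the product form of `X_t 1{τ = t}`, with `t = i + 1`. -/
noncomputable def stopFactor (m : ℕ) (θ : ℝ≥0) (i j : Fin (m + 1)) (z : ℝ × Bool) : ℝ :=
  if j < i then (acceptSet θ)ᶜ.indicator 1 z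
  else if j = i then (if i = Fin.last m then z.1 else (acceptSet θ).indicator Prod.fst z)
  else 1

/-- Each summand becomes a product of functions of separate pairs (X_j, ξ_j), so independence turns
its expectation into a product. -/
lemma stoppedObservation_eq (m : ℕ) (θ : ℝ≥0) (x : Fin (m + 1) → ℝ) (ξ : Fin (m + 1) → Bool) :
    stoppedObservation (m + 1) θ x ξ = ∑ i, ∏ j, stopFactor m θ i j (x j, ξ j) := by
  classical
  unfold stoppedObservation
  refine Finset.sum_congr rfl fun i _ => ?_
  rw [← Finset.mul_prod_erase _ _ (Finset.mem_univ i)]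
  have hi : stopFactor m θ i i (x i, ξ i)
      = if i = Fin.last m ∨ (x i, ξ i) ∈ acceptSet θ then x i else 0 := by
    by_cases h1 : i = Fin.last m <;> by_cases h2 : (x i, ξ i) ∈ acceptSet θ <;>
      simp [stopFactor, h1, h2]
  rw [hi]
  rw [if_congr (stoppingTime_eq_iff m θ x ξ i) rfl rfl]
  by_cases h1 : ∀ j < i, (x j, ξ j) ∉ acceptSet θ
  · rw [Finset.prod_eq_one, mul_one]
    · exact if_congr (and_iff_right h1) rfl rfl
    · intro j hj
      have hj' : j ≠ i := (Finset.mem_erase.1 hj).1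
      by_cases hlt : j < i
      · simp [stopFactor, hlt, h1 j hlt]
      · simp [stopFactor, hlt, hj']
  · rw [if_neg (fun h => h1 h.1)]
    push Not at h1
    obtain ⟨j, hj, hacc⟩ := h1
    rw [Finset.prod_eq_zero (i := j), mul_zero]
    · simp [hj.ne]
    · simp [stopFactor, hj, hacc]

variable {F : ProbabilityMeasure ℝ}

lemma real_reject (τ : ThresholdRule) (F : ProbabilityMeasure ℝ) :
    ((F : Measure ℝ).prod (bernoulliMeasure true false τ.p)).real (acceptSet τ.θ)ᶜ
      = rejectProb τ F := by
  have h : (acceptSet τ.θ)ᶜ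
      = (Set.Iio (τ.θ : ℝ) ×ˢ Set.univ) ∪ ({(τ.θ : ℝ)} ×ˢ {false}) := by
    ext ⟨a, b⟩
    simp only [acceptSet, Set.mem_compl_iff, Set.mem_ofPred_eq, not_or, not_lt, not_and,
      Bool.not_eq_true, Set.mem_union, Set.mem_prod, Set.mem_Iio, Set.mem_univ, and_true,
      Set.mem_singleton_iff]
    constructor
    · rintro ⟨h1, h2⟩
      rcases h1.lt_or_eq with h | h
      · exact Or.inl h
      · exact Or.inr ⟨h, h2 h⟩
    · rintro (h | ⟨h, h'⟩)
      · exact ⟨h.le, fun e => absurd e h.ne⟩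
      · exact ⟨h.le, fun _ => h'⟩
  rw [h, measureReal_union]
  · rw [measureReal_prod_prod, measureReal_prod_prod, rejectProb]
    simp [mul_comm]
  · rw [Set.disjoint_left]
    rintro ⟨a, b⟩ ⟨h1, -⟩ ⟨h2, -⟩
    simp only [Set.mem_Iio, Set.mem_singleton_iff] at h1 h2
    exact h1.ne h2
  · exact (measurableSet_singleton _).prod (measurableSet_singleton _)

lemma rejectProb_nonneg (τ : ThresholdRule) (F : ProbabilityMeasure ℝ) : 0 ≤ rejectProb τ F :=
  real_reject τ F ▸ measureReal_nonneg

lemma rejectProb_le_one (τ : ThresholdRule) (F : ProbabilityMeasure ℝ) : rejectProb τ F ≤ 1 :=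
  real_reject τ F ▸ measureReal_le_one

lemma real_Ioi_eq (F : ProbabilityMeasure ℝ) (s : ℝ) :
    (F : Measure ℝ).real (Set.Ioi s) = 1 - cdf (F : Measure ℝ) s := by
  rw [cdf_eq_real, ← Set.compl_Iic, probReal_compl_eq_one_sub measurableSet_Iic]

/-- The tail formula for the reward that is collected by accepting a given observation. -/
lemma integral_accept (hF : ∀ᵐ x ∂(F : Measure ℝ), 0 ≤ x)
    (hi : Integrable (fun x : ℝ => x) (F : Measure ℝ)) (τ : ThresholdRule) :
    ∫ z, (acceptSet τ.θ).indicator Prod.fst z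
        ∂((F : Measure ℝ).prod (bernoulliMeasure true false τ.p))
      = ∫ s in Set.Ioi (0 : ℝ), (1 - max (rejectProb τ F) (cdf (F : Measure ℝ) s)) := by
  have hint : Integrable (fun z : ℝ × Bool => z.1)
      ((F : Measure ℝ).prod (bernoulliMeasure true false τ.p)) := hi.comp_fst _
  have hnn : ∀ᵐ z ∂((F : Measure ℝ).prod (bernoulliMeasure true false τ.p)), 0 ≤ z.1 :=
    Measure.quasiMeasurePreserving_fst.ae hF
  rw [(hint.indicator (measurableSet_acceptSet τ.θ)).integral_eq_integral_meas_lt]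
  · refine setIntegral_congr_fun measurableSet_Ioi fun s (hs : 0 < s) => ?_
    have hset : {z : ℝ × Bool | s < (acceptSet τ.θ).indicator Prod.fst z}
        = {z | s < z.1} ∩ acceptSet τ.θ := by
      ext z
      by_cases hz : z ∈ acceptSet τ.θ
      · simp [hz]
      · simp [hz, hs.le]
    rw [hset]
    -- For s ≥ θ, every value above s is accepted; for s < θ, every accepted value exceeds s. So the
    -- event has probability 1 - F(s) or 1 - x, whichever is smaller.
    rcases le_or_gt (τ.θ : ℝ) s with h | h
    · have h1 : {z : ℝ × Bool | s < z.1} ∩ acceptSet τ.θ = Set.Ioi s ×ˢ Set.univ := by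
        ext z
        simp only [acceptSet, Set.mem_inter_iff, Set.mem_ofPred_eq, Set.mem_prod, Set.mem_Ioi,
          Set.mem_univ, and_true, and_iff_left_iff_imp]
        exact fun hz => Or.inl (h.trans_lt hz)
      have h2 : rejectProb τ F ≤ cdf (F : Measure ℝ) s := by
        rw [cdf_eq_real]
        have e1 : (F : Measure ℝ).real (Set.Iio (τ.θ : ℝ)) + (F : Measure ℝ).real {(τ.θ : ℝ)}
            = (F : Measure ℝ).real (Set.Iic (τ.θ : ℝ)) := by
          rw [← measureReal_union (by simp) (measurableSet_singleton _), Set.Iio_union_right]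
        have e2 : (F : Measure ℝ).real (Set.Iic (τ.θ : ℝ)) ≤ (F : Measure ℝ).real (Set.Iic s) :=
          measureReal_mono (Set.Iic_subset_Iic.2 h)
        have e3 : 0 ≤ (τ.p : ℝ) * (F : Measure ℝ).real {(τ.θ : ℝ)} :=
          mul_nonneg τ.p.2.1 measureReal_nonneg
        unfold rejectProb
        linarith
      rw [h1, measureReal_prod_prod, max_eq_right h2, real_Ioi_eq]
      simp
    · have h1 : {z : ℝ × Bool | s < z.1} ∩ acceptSet τ.θ = acceptSet τ.θ := by
        refine Set.inter_eq_right.2 fun z hz => ?_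
        rcases hz with hz | hz
        · exact h.trans hz
        · exact h.trans_eq hz.1.symm
      have h2 : cdf (F : Measure ℝ) s ≤ rejectProb τ F := by
        rw [cdf_eq_real]
        have e2 : (F : Measure ℝ).real (Set.Iic s) ≤ (F : Measure ℝ).real (Set.Iio (τ.θ : ℝ)) :=
          measureReal_mono (Set.Iic_subset_Iio.2 h)
        have e3 : 0 ≤ (1 - τ.p : ℝ) * (F : Measure ℝ).real {(τ.θ : ℝ)} :=
          mul_nonneg (sub_nonneg.2 τ.p.2.2) measureReal_nonneg
        unfold rejectProb
        linarith
      rw [h1, max_eq_left h2, ← real_reject, probReal_compl_eq_one_sub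
        (measurableSet_acceptSet τ.θ), sub_sub_cancel]
  · filter_upwards [hnn] with z hz
    exact Set.indicator_apply_nonneg fun _ => hz

lemma integral_id_eq (hF : ∀ᵐ x ∂(F : Measure ℝ), 0 ≤ x)
    (hi : Integrable (fun x : ℝ => x) (F : Measure ℝ)) :
    ∫ x, x ∂(F : Measure ℝ) = ∫ s in Set.Ioi (0 : ℝ), (1 - cdf (F : Measure ℝ) s) := by
  rw [hi.integral_eq_integral_meas_lt hF]
  exact integral_congr_ae (Filter.Eventually.of_forall fun s => real_Ioi_eq F s)

lemma integrable_one_sub_cdf (hF : ∀ᵐ x ∂(F : Measure ℝ), 0 ≤ x)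
    (hi : Integrable (fun x : ℝ => x) (F : Measure ℝ)) :
    IntegrableOn (fun s => 1 - cdf (F : Measure ℝ) s) (Set.Ioi (0 : ℝ)) := by
  have hm : Measurable fun s => 1 - cdf (F : Measure ℝ) s :=
    measurable_const.sub (monotone_cdf _).measurable
  refine ⟨hm.aestronglyMeasurable, ?_⟩
  rw [hasFiniteIntegral_iff_ofReal
    (Filter.Eventually.of_forall fun s => sub_nonneg.2 (cdf_le_one _ s))]
  have h := lintegral_eq_lintegral_meas_lt (F : Measure ℝ) hF hi.aemeasurable
  have h2 : ∀ s, ENNReal.ofReal (1 - cdf (F : Measure ℝ) s) = (F : Measure ℝ) {x | s < x} := by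
    intro s
    rw [← real_Ioi_eq, ofReal_measureReal]
    rfl
  simp_rw [h2]
  rw [← h]
  exact hi.lintegral_lt_top

/-- A measurable function of the distribution function is integrable on `(0, ∞)` as soon as it is
dominated by a multiple of `1 - F`. -/
lemma integrableOn_comp_cdf (hF : ∀ᵐ x ∂(F : Measure ℝ), 0 ≤ x)
    (hi : Integrable (fun x : ℝ => x) (F : Measure ℝ)) {g : ℝ → ℝ} (hg : Measurable g) (C : ℝ)
    (hgb : ∀ y, 0 ≤ y → y ≤ 1 → |g y| ≤ C * (1 - y)) :
    IntegrableOn (fun s => g (cdf (F : Measure ℝ) s)) (Set.Ioi (0 : ℝ)) :=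
  ((integrable_one_sub_cdf hF hi).const_mul C).mono'
    (hg.comp (monotone_cdf _).measurable).aestronglyMeasurable
    (Filter.Eventually.of_forall fun s => hgb _ (cdf_nonneg _ s) (cdf_le_one _ s))

/-- Stopping at index i < m means i rejections followed by an acceptance, which gives a geometric
sum. Reaching the last index costs m rejections and pays the plain mean. -/
lemma reward_eq_aux (m : ℕ) (hi : Integrable (fun x : ℝ => x) (F : Measure ℝ))
    (τ : ThresholdRule) :
    reward (m + 1) τ F = geomSum m (rejectProb τ F) *
        ∫ z, (acceptSet τ.θ).indicator Prod.fst z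
          ∂((F : Measure ℝ).prod (bernoulliMeasure true false τ.p))
      + rejectProb τ F ^ m * ∫ x, x ∂(F : Measure ℝ) := by
  set ρ := (F : Measure ℝ).prod (bernoulliMeasure true false τ.p) with hρ
  have hint : Integrable (fun z : ℝ × Bool => z.1) ρ := hi.comp_fst _
  have hA := measurableSet_acceptSet τ.θ
  have hfac : ∀ i j, Integrable (stopFactor m τ.θ i j) ρ := by
    intro i j
    unfold stopFactor
    by_cases h1 : j < i
    · simp only [h1, if_true]
      exact (integrable_const (1 : ℝ)).indicator hA.compl
    by_cases h2 : j = i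
    · by_cases h3 : i = Fin.last m
      · simpa only [h1, h2, h3, lt_irrefl, if_true, if_false] using hint
      · simp only [h2, h3, lt_irrefl, if_true, if_false]
        exact hint.indicator hA
    · simp only [h1, h2, if_false]
      exact integrable_const _
  -- Regroup the sample as iid pairs (observation, coin).
  have hmp := measurePreserving_arrowProdEquivProdArrow ℝ Bool (Fin (m + 1))
    (fun _ => (F : Measure ℝ)) (fun _ => bernoulliMeasure true false τ.p)
  rw [reward, sampleLaw, ← hmp.integral_comp']
  have hval : ∀ i : Fin (m + 1), ∏ j, ∫ z, stopFactor m τ.θ i j z ∂ρ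
      = rejectProb τ F ^ (i : ℕ) * ∫ z, stopFactor m τ.θ i i z ∂ρ := by
    intro i
    have h : ∀ j, ∫ z, stopFactor m τ.θ i j z ∂ρ = (if j < i then rejectProb τ F else 1) *
        (if j = i then ∫ z, stopFactor m τ.θ i i z ∂ρ else 1) := by
      intro j
      by_cases h1 : j < i
      · simp only [stopFactor, h1, if_true, h1.ne, if_false, mul_one]
        rw [integral_indicator_one hA.compl, real_reject]
      by_cases h2 : j = i
      · simp only [h2, lt_irrefl, if_true, if_false, one_mul]
      · simp only [stopFactor, h1, h2, if_false, mul_one]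
        simp [hρ]
    rw [Finset.prod_congr rfl fun j _ => h j, Finset.prod_mul_distrib,
      Finset.prod_ite_eq' Finset.univ i]
    simp only [Finset.prod_ite, Finset.prod_const, one_pow, mul_one, Finset.mem_univ, if_true]
    congr 2
    rw [← Fin.card_Iio, Finset.filter_gt_eq_Iio]
  calc _ = ∫ w : Fin (m + 1) → ℝ × Bool, ∑ i : Fin (m + 1), ∏ j, stopFactor m τ.θ i j (w j)
        ∂(Measure.pi fun _ => ρ) := by
        refine integral_congr_ae (Filter.Eventually.of_forall fun w => ?_)
        exact stoppedObservation_eq m τ.θ _ _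
    _ = ∑ i : Fin (m + 1), rejectProb τ F ^ (i : ℕ) * ∫ z, stopFactor m τ.θ i i z ∂ρ := by
        rw [integral_finsetSum]
        · refine Finset.sum_congr rfl fun i _ => ?_
          rw [integral_fintype_prod_eq_prod (f := fun j => stopFactor m τ.θ i j), hval]
        · exact fun i _ => Integrable.fintype_prod (f := fun j => stopFactor m τ.θ i j) (hfac i)
    _ = _ := by
        rw [Fin.sum_univ_castSucc]
        congr 1
        · rw [geomSum, Finset.sum_mul, ← Fin.sum_univ_eq_sum_range
            (fun k => rejectProb τ F ^ k * ∫ z, (acceptSet τ.θ).indicator Prod.fst z ∂ρ)]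
          refine Finset.sum_congr rfl fun i _ => ?_
          simp [stopFactor, (Fin.castSucc_lt_last i).ne]
        · have : ∫ z, z.1 ∂ρ = ∫ x, x ∂(F : Measure ℝ) := by
            rw [hρ, integral_fun_fst (fun x : ℝ => x)]
            simp
          simp [stopFactor, this]

/-- The expected reward of a rule depends on the rule through its rejection probability only. -/
theorem reward_eq (m : ℕ) (hF : ∀ᵐ x ∂(F : Measure ℝ), 0 ≤ x)
    (hi : Integrable (fun x : ℝ => x) (F : Measure ℝ)) (τ : ThresholdRule) :
    reward (m + 1) τ F
      = ∫ s in Set.Ioi (0 : ℝ), rewardKernel (m + 1) (rejectProb τ F) (cdf (F : Measure ℝ) s) := by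
  rw [reward_eq_aux m hi, integral_accept hF hi, integral_id_eq hF hi]
  unfold rewardKernel
  simp only [add_tsub_cancel_right]
  have hr := rejectProb_le_one τ F
  rw [integral_add, integral_const_mul, integral_const_mul]
  · refine Integrable.const_mul ?_ _
    refine integrableOn_comp_cdf (g := fun y => 1 - max (rejectProb τ F) y) hF hi (by fun_prop) 1
      fun y hy hy1 => ?_
    rw [abs_of_nonneg (sub_nonneg.2 (max_le hr hy1)), one_mul]
    linarith [le_max_right (rejectProb τ F) y]
  · exact (integrable_one_sub_cdf hF hi).const_mul _

/-- The tail formula for the expected maximum. -/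
theorem prophetValue_eq (m : ℕ) (hF : ∀ᵐ x ∂(F : Measure ℝ), 0 ≤ x)
    (hi : Integrable (fun x : ℝ => x) (F : Measure ℝ)) :
    prophetValue (m + 1) F
      = ∫ s in Set.Ioi (0 : ℝ), (1 - cdf (F : Measure ℝ) s ^ (m + 1)) := by
  set P := Measure.pi fun _ : Fin (m + 1) => (F : Measure ℝ)
  have hcoord : ∀ i, Integrable (fun x : Fin (m + 1) → ℝ => x i) P := fun i =>
    (measurePreserving_eval (fun _ : Fin (m + 1) => (F : Measure ℝ))
      i).integrable_comp_of_integrable hi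
  have hnn : ∀ᵐ x ∂P, ∀ i, 0 ≤ x i := by
    rw [ae_all_iff]
    exact fun i => (measurePreserving_eval (fun _ : Fin (m + 1) => (F : Measure ℝ))
      i).quasiMeasurePreserving.ae hF
  have hmeas : Measurable fun x : Fin (m + 1) → ℝ => ⨆ i, x i :=
    Measurable.iSup fun i => measurable_pi_apply i
  have hsup : ∀ᵐ x ∂P, 0 ≤ ⨆ i, x i := by
    filter_upwards [hnn] with x hx
    exact Real.iSup_nonneg hx
  have hint : Integrable (fun x : Fin (m + 1) → ℝ => ⨆ i, x i) P := by
    refine (integrable_finsetSum Finset.univ fun i _ => hcoord i).mono'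
      hmeas.aestronglyMeasurable ?_
    filter_upwards [hnn, hsup] with x hx hx'
    rw [Real.norm_of_nonneg hx']
    exact ciSup_le fun i => Finset.single_le_sum (f := fun i => x i) (fun j _ => hx j)
      (Finset.mem_univ i)
  rw [prophetValue, hint.integral_eq_integral_meas_lt hsup]
  refine integral_congr_ae (Filter.Eventually.of_forall fun s => ?_)
  have hset : {x : Fin (m + 1) → ℝ | s < ⨆ i, x i} = (Set.univ.pi fun _ => Set.Iic s)ᶜ := by
    ext x
    simp only [Set.mem_ofPred_eq, Set.mem_compl_iff, Set.mem_univ_pi, Set.mem_Iic, ← not_le,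
      ciSup_le_iff (Set.finite_range x).bddAbove]
  beta_reduce
  rw [hset, probReal_compl_eq_one_sub (MeasurableSet.univ_pi fun _ => measurableSet_Iic),
    measureReal_def, Measure.pi_pi, cdf_eq_real, measureReal_def]
  simp

end

/-! ## Rejection probabilities and laws on the grid -/

section

/-- Every number strictly between `0` and `1` is the rejection probability of some rule. -/
lemma exists_rejectProb_eq {F : ProbabilityMeasure ℝ} (hF : ∀ᵐ x ∂(F : Measure ℝ), 0 ≤ x)
    {x : ℝ} (hx : 0 < x) (hx1 : x < 1) : ∃ τ : ThresholdRule, rejectProb τ F = x := by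
  set f := cdf (F : Measure ℝ) with hf
  set S : Set ℝ := {s | x ≤ f s} with hS
  have hneg : ∀ s < 0, f s = 0 := by
    intro s hs
    rw [hf, cdf_eq_real, measureReal_eq_zero_iff, measure_eq_zero_iff_ae_notMem]
    filter_upwards [hF] with y hy
    simp only [Set.mem_Iic, not_le]
    exact hs.trans_le hy
  have hlb : ∀ s ∈ S, 0 ≤ s := by
    intro s hs
    by_contra h
    have h1 : x ≤ f s := hs
    rw [hneg s (not_le.1 h)] at h1
    exact absurd h1 (not_le.2 hx)
  have hbdd : BddBelow S := ⟨0, hlb⟩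
  have hne : S.Nonempty :=
    (((tendsto_cdf_atTop (F : Measure ℝ)).eventually (lt_mem_nhds hx1)).exists).imp
      fun _ h => le_of_lt h
  -- The x-quantile of F. It satisfies F(θ-) ≤ x ≤ F(θ), and the coin interpolates across the atom
  -- at θ.
  set θ := sInf S with hθ
  have hθ0 : 0 ≤ θ := le_csInf hne hlb
  have hle : x ≤ f θ := by
    have ht : Filter.Tendsto f (nhdsWithin θ (Set.Ioi θ)) (nhds (f θ)) :=
      (f.right_continuous θ).mono Set.Ioi_subset_Ici_self
    refine ge_of_tendsto ht ?_
    filter_upwards [self_mem_nhdsWithin] with s (hs : θ < s)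
    obtain ⟨t, ht, hts⟩ := (csInf_lt_iff hbdd hne).1 hs
    exact le_trans ht (f.mono hts.le)
  have hge : (F : Measure ℝ).real (Set.Iio θ) ≤ x := by
    have h1 : (F : Measure ℝ).real (Set.Iio θ) = Function.leftLim f θ := by
      have h0 : 0 ≤ Function.leftLim f θ :=
        (cdf_nonneg (F : Measure ℝ) (θ - 1)).trans (f.mono.le_leftLim (by linarith))
      rw [measureReal_def, ← measure_cdf (F : Measure ℝ),
        StieltjesFunction.measure_Iio _ (tendsto_cdf_atBot _), sub_zero, ENNReal.toReal_ofReal h0]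
    rw [h1]
    refine le_of_tendsto (f.mono.tendsto_leftLim θ) ?_
    filter_upwards [self_mem_nhdsWithin] with s (hs : s < θ)
    exact le_of_lt (not_le.1 fun h => absurd (csInf_le hbdd h) (not_le.2 hs))
  set a := (F : Measure ℝ).real (Set.Iio θ) with ha
  set b := (F : Measure ℝ).real {θ} with hb
  have hab : x ≤ a + b := by
    rw [ha, hb, ← measureReal_union (by simp) (measurableSet_singleton _), Set.Iio_union_right,
      ← cdf_eq_real]
    exact hle
  have hb0 : 0 ≤ b := measureReal_nonneg
  have hq0 : 0 ≤ (x - a) / b := div_nonneg (sub_nonneg.2 hge) hb0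
  have hq1 : (x - a) / b ≤ 1 := div_le_one_of_le₀ (by linarith) hb0
  -- This p solves a + (1 - p) b = x. Without an atom (b = 0) the quotient is 0 by convention, and a
  -- = x already.
  refine ⟨⟨⟨θ, hθ0⟩, ⟨1 - (x - a) / b, by linarith, by linarith⟩⟩, ?_⟩
  change a + (1 - (1 - (x - a) / b)) * b = x
  rcases hb0.eq_or_lt with h | h
  · rw [← h] at hab ⊢
    linarith
  · field_simp
    ring

/-- The uniform distribution on the partial sums `0, w 0, w 0 + w 1, …` with `N` terms. -/
noncomputable def partialSumMeasure (N : ℕ) (w : ℕ → ℝ) : Measure ℝ :=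
  (N : NNReal)⁻¹ • ∑ j ∈ Finset.range N, Measure.dirac (∑ i ∈ Finset.range j, w i)

lemma isProbabilityMeasure_partialSumMeasure {N : ℕ} (hN : N ≠ 0) (w : ℕ → ℝ) :
    IsProbabilityMeasure (partialSumMeasure N w) := by
  constructor
  have : (N : ENNReal) ≠ 0 := by exact_mod_cast hN
  simp [partialSumMeasure, ENNReal.smul_def, ENNReal.coe_inv, hN,
    ENNReal.inv_mul_cancel this (ENNReal.natCast_ne_top N)]

/-- The uniform distribution on the partial sums of `w`, as a probability measure. -/
noncomputable def partialSumLaw (N : ℕ) (hN : N ≠ 0) (w : ℕ → ℝ) : ProbabilityMeasure ℝ :=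
  ⟨partialSumMeasure N w, isProbabilityMeasure_partialSumMeasure hN w⟩

lemma ae_partialSumMeasure {N : ℕ} {w : ℕ → ℝ} {p : ℝ → Prop} (hp : MeasurableSet {x | p x})
    (h : ∀ j < N, p (∑ i ∈ Finset.range j, w i)) : ∀ᵐ x ∂partialSumMeasure N w, p x := by
  unfold partialSumMeasure
  refine Measure.ae_smul_measure ?_ _
  rw [ae_finsetSum_measure_iff]
  exact fun j hj => (ae_dirac_iff hp).2 (h j (Finset.mem_range.1 hj))

lemma integrable_partialSumMeasure (N : ℕ) (w : ℕ → ℝ) :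
    Integrable (fun x : ℝ => x) (partialSumMeasure N w) := by
  unfold partialSumMeasure
  refine Integrable.smul_measure_nnreal ?_
  exact integrable_finsetSum_measure.2 fun j _ => integrable_dirac (by simp)

lemma cdf_partialSumLaw (N : ℕ) (hN : N ≠ 0) (w : ℕ → ℝ) (t : ℝ) :
    cdf (partialSumLaw N hN w : Measure ℝ) t
      = ((Finset.range N).filter fun j => ∑ i ∈ Finset.range j, w i ≤ t).card / N := by
  have h : (partialSumLaw N hN w : Measure ℝ) = partialSumMeasure N w := rfl
  rw [cdf_eq_real, h, partialSumMeasure, measureReal_nnreal_smul_apply, measureReal_def,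
    Measure.finsetSum_apply, Finset.card_filter]
  rw [ENNReal.toReal_sum fun _ _ => measure_ne_top _ _]
  push_cast
  rw [div_eq_inv_mul]
  congr 1
  refine Finset.sum_congr rfl fun j _ => ?_
  by_cases hj : ∑ i ∈ Finset.range j, w i ≤ t <;> simp [hj]

/-- The distribution function of `partialSumLaw N hN w` spends time `w i` at height
`(i + 1) / N`. -/
lemma integral_comp_cdf_partialSumLaw (N : ℕ) (hN : N ≠ 0) {w : ℕ → ℝ} (hw : ∀ i, 0 ≤ w i)
    {g : ℝ → ℝ} (hg : g 1 = 0) :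
    ∫ t in Set.Ioi (0 : ℝ), g (cdf (partialSumLaw N hN w : Measure ℝ) t)
      = ∑ i ∈ Finset.range (N - 1), w i * g ((i + 1 : ℝ) / N) := by
  set s : ℕ → ℝ := fun j => ∑ i ∈ Finset.range j, w i with hs
  have hstep : ∀ j, s (j + 1) = s j + w j := fun j => Finset.sum_range_succ _ _
  have hmono : Monotone s := monotone_nat_of_le_succ fun j => by linarith [hstep j, hw j]
  have hs0 : s 0 = 0 := by simp [hs]
  have key : ∀ t, 0 ≤ t → g (cdf (partialSumLaw N hN w : Measure ℝ) t)
      = ∑ i ∈ Finset.range (N - 1),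
        (Set.Ico (s i) (s (i + 1))).indicator (fun _ => g ((i + 1 : ℝ) / N)) t := by
    intro t ht
    rw [cdf_partialSumLaw]
    -- The number of partial sums up to t, so that F(t) = c/N. Monotonicity of the partial sums puts
    -- t in [s i, s (i + 1)) exactly when c = i + 1, and a zero weight gives an empty interval.
    set c := ((Finset.range N).filter fun j => s j ≤ t).card with hc
    have hlt : ∀ j < N, (s j ≤ t ↔ j < c) := by
      intro j hj
      constructor
      · intro h
        rw [← Nat.succ_le_iff, hc, ← Finset.card_range j.succ]
        refine Finset.card_le_card fun k hk => ?_
        have hk' : k ≤ j := Nat.lt_succ_iff.1 (Finset.mem_range.1 hk)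
        exact Finset.mem_filter.2 ⟨Finset.mem_range.2 (hk'.trans_lt hj), (hmono hk').trans h⟩
      · intro h
        by_contra hn
        refine absurd h (not_lt.2 ?_)
        rw [hc, ← Finset.card_range j]
        refine Finset.card_le_card fun k hk => Finset.mem_range.2 ?_
        by_contra hjk
        exact hn ((hmono (not_lt.1 hjk)).trans (Finset.mem_filter.1 hk).2)
    have hcN : c ≤ N := by
      simpa using Finset.card_filter_le (Finset.range N) fun j => s j ≤ t
    have hc1 : 0 < c := (hlt 0 (Nat.pos_of_ne_zero hN)).1 (hs0 ▸ ht)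
    have hterm : ∀ i ∈ Finset.range (N - 1),
        (Set.Ico (s i) (s (i + 1))).indicator (fun _ => g ((i + 1 : ℝ) / N)) t
          = if i = c - 1 then g ((c : ℝ) / N) else 0 := by
      intro i hi
      have hi' := Finset.mem_range.1 hi
      have h1 := hlt i (by omega)
      have h2 := hlt (i + 1) (by omega)
      by_cases hic : i = c - 1
      · have hm : t ∈ Set.Ico (s i) (s (i + 1)) :=
          ⟨h1.2 (by omega), not_le.1 fun h => by have := h2.1 h; omega⟩
        have hcast : (c : ℝ) = i + 1 := by
          have : c = i + 1 := by omega
          exact_mod_cast this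
        rw [Set.indicator_of_mem hm, if_pos hic, hcast]
      · have hm : t ∉ Set.Ico (s i) (s (i + 1)) := by
          rintro ⟨h3, h4⟩
          have h5 := h1.1 h3
          have h6 : ¬ i + 1 < c := fun h => absurd (h2.2 h) (not_le.2 h4)
          omega
        rw [Set.indicator_of_notMem hm, if_neg hic]
    rw [Finset.sum_congr rfl hterm, Finset.sum_ite_eq']
    split_ifs with h
    · rfl
    -- Beyond the last partial sum the distribution function is 1, and g 1 = 0 makes this unbounded
    -- range contribute nothing.
    · have : c = N := by
        rw [Finset.mem_range] at h
        omega
      rw [this, div_self (by exact_mod_cast hN), hg]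
  rw [← integral_Ici_eq_integral_Ioi, setIntegral_congr_fun measurableSet_Ici fun t ht => key t ht,
    integral_finsetSum]
  · refine Finset.sum_congr rfl fun i _ => ?_
    rw [integral_indicator_const _ measurableSet_Ico, measureReal_restrict_apply measurableSet_Ico,
      Set.inter_eq_left.2, Real.volume_real_Ico_of_le (hmono i.le_succ), hstep, smul_eq_mul]
    · ring
    · exact fun t ht => (hs0 ▸ hmono i.zero_le : (0 : ℝ) ≤ s i).trans ht.1
  · intro i _
    refine (integrable_indicator_iff measurableSet_Ico).2 ?_
    rw [IntegrableOn, Measure.restrict_restrict measurableSet_Ico]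
    exact integrableOn_const
      ((measure_mono Set.inter_subset_left).trans_lt measure_Ico_lt_top).ne

/-- Grouping an integral by the values of a rounding function. -/
lemma sum_integral_indicator_mul {α : Type*} [MeasurableSpace α] {κ : Measure α} {k : ℕ}
    {r : α → Fin k} (hr : Measurable r) {w : α → ℝ} (hw : Integrable w κ) (c : Fin k → ℝ) :
    ∑ j, c j * ∫ s, (r ⁻¹' {j}).indicator w s ∂κ = ∫ s, c (r s) * w s ∂κ := by
  have h : ∀ s, c (r s) * w s = ∑ j, c j * (r ⁻¹' {j}).indicator w s := by
    intro s
    rw [Finset.sum_eq_single (r s)]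
    · simp
    · intro j _ hj
      simp [hj.symm]
    · simp
  simp_rw [h]
  rw [integral_finsetSum _ fun j _ =>
    (hw.indicator (hr (measurableSet_singleton j))).const_mul (c j)]
  simp_rw [integral_const_mul]

end

/-! ## Rounding to the grid -/

section

/-- The index of the grid point that `z / N` is rounded down to; below the first grid point, the
index of the first grid point. -/
noncomputable def floorIndex (N : ℕ) (hN : 2 ≤ N) (z : ℝ) : Fin (N - 1) :=
  ⟨min (⌊z⌋₊ - 1) (N - 2), by omega⟩

lemma measurable_floorIndex (N : ℕ) (hN : 2 ≤ N) : Measurable (floorIndex N hN) :=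
  (measurable_from_top (f := fun k : ℕ => (⟨min (k - 1) (N - 2), by omega⟩ : Fin (N - 1)))).comp
    Nat.measurable_floor

variable {N : ℕ}

lemma gridPoint_mul (hN : 2 ≤ N) (i : Fin (N - 1)) : gridPoint N i * N = (i : ℕ) + 1 := by
  have : (N : ℝ) ≠ 0 := by norm_cast; omega
  rw [gridPoint, div_mul_cancel₀ _ this]

lemma gridPoint_pos (hN : 2 ≤ N) (i : Fin (N - 1)) : 0 < gridPoint N i := by
  have : (0 : ℝ) < N := by norm_cast; omega
  unfold gridPoint
  positivity

lemma gridPoint_lt_one (hN : 2 ≤ N) (i : Fin (N - 1)) : gridPoint N i < 1 := by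
  have : (0 : ℝ) < N := by norm_cast; omega
  rw [gridPoint, div_lt_one this]
  have := i.2
  have h : (i : ℕ) + 1 < N := by omega
  exact_mod_cast h

lemma one_le_gridPoint_mul (hN : 2 ≤ N) (i : Fin (N - 1)) : 1 ≤ gridPoint N i * N := by
  rw [gridPoint_mul hN]
  linarith [(i : ℕ).cast_nonneg (α := ℝ)]

lemma gridPoint_mul_le (hN : 2 ≤ N) (i : Fin (N - 1)) : gridPoint N i * N ≤ N - 1 := by
  rw [gridPoint_mul hN, le_sub_iff_add_le]
  have := i.2
  have h : (i : ℕ) + 1 + 1 ≤ N := by omega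
  exact_mod_cast h

lemma gridPoint_floorIndex_mul_le (hN : 2 ≤ N) {z : ℝ} (hz : 1 ≤ z) :
    gridPoint N (floorIndex N hN z) * N ≤ z := by
  rw [gridPoint_mul hN]
  have h1 : 1 ≤ ⌊z⌋₊ := Nat.one_le_floor_iff z |>.2 hz
  have h2 : ((floorIndex N hN z : Fin (N - 1)) : ℕ) + 1 ≤ ⌊z⌋₊ := by
    simp only [floorIndex]
    omega
  exact le_trans (by exact_mod_cast h2) (Nat.floor_le (zero_le_one.trans hz))

lemma lt_gridPoint_floorIndex_mul (hN : 2 ≤ N) {z : ℝ} (hz : z < N) :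
    z < gridPoint N (floorIndex N hN z) * N + 1 := by
  rw [gridPoint_mul hN]
  have h1 : ⌊z⌋₊ < N := (Nat.floor_lt' (by omega)).2 hz
  have h2 : ⌊z⌋₊ + 1 ≤ ((floorIndex N hN z : Fin (N - 1)) : ℕ) + 1 + 1 := by
    simp only [floorIndex]
    omega
  exact (Nat.lt_floor_add_one z).trans_le (by exact_mod_cast h2)

lemma gridPoint_floorIndex_of_lt_one (hN : 2 ≤ N) {z : ℝ} (hz : z < 1) :
    gridPoint N (floorIndex N hN z) * N = 1 := by
  have h1 : ⌊z⌋₊ = 0 := Nat.floor_eq_zero.2 hz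
  rw [gridPoint_mul hN]
  simp [floorIndex, h1]

lemma gridPoint_floorIndex_of_ge (hN : 2 ≤ N) {z : ℝ} (hz : (N : ℝ) ≤ z) :
    gridPoint N (floorIndex N hN z) * N = N - 1 := by
  have h1 : N ≤ ⌊z⌋₊ := Nat.le_floor hz
  rw [gridPoint_mul hN, eq_sub_iff_add_eq]
  have h2 : ((floorIndex N hN z : Fin (N - 1)) : ℕ) + 1 + 1 = N := by
    simp only [floorIndex]
    omega
  exact_mod_cast h2

/-- There is no grid point strictly between a grid point and the next one. -/
lemma gridPoint_le_or_ge (hN : 2 ≤ N) (i j : Fin (N - 1)) {y : ℝ}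
    (hy : y * N < gridPoint N j * N + 1) : gridPoint N i ≤ gridPoint N j ∨ y ≤ gridPoint N i := by
  have hN0 : (0 : ℝ) < N := by norm_cast; omega
  rcases le_or_gt (i : ℕ) j with h | h
  · left
    refine le_of_mul_le_mul_right ?_ hN0
    rw [gridPoint_mul hN, gridPoint_mul hN]
    have : ((i : ℕ) : ℝ) ≤ ((j : ℕ) : ℝ) := by exact_mod_cast h
    linarith
  · right
    refine le_of_mul_le_mul_right ?_ hN0
    rw [gridPoint_mul hN] at hy ⊢
    have : ((j : ℕ) : ℝ) + 1 ≤ ((i : ℕ) : ℝ) := by exact_mod_cast h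
    linarith

/-- Adding 1/2 before taking the floor rounds to the nearest grid point. -/
lemma abs_sub_gridPoint_le (hN : 2 ≤ N) {y : ℝ} (h1 : 1 ≤ y * N + 1 / 2)
    (h2 : y * N + 1 / 2 < N) :
    |y - gridPoint N (floorIndex N hN (y * N + 1 / 2))| ≤ 1 / (2 * N) := by
  have hN0 : (0 : ℝ) < N := by norm_cast; omega
  have e1 := gridPoint_floorIndex_mul_le hN h1
  have e2 := lt_gridPoint_floorIndex_mul hN h2
  rw [abs_le, neg_le_sub_iff_le_add, sub_le_iff_le_add']
  constructor
  · refine le_of_mul_le_mul_right ?_ hN0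
    have : (y + 1 / (2 * (N : ℝ))) * N = y * N + 1 / 2 := by field_simp
    linarith
  · refine le_of_mul_le_mul_right ?_ hN0
    have : (gridPoint N (floorIndex N hN (y * N + 1 / 2)) + 1 / (2 * (N : ℝ))) * N
      = gridPoint N (floorIndex N hN (y * N + 1 / 2)) * N + 1 / 2 := by field_simp
    linarith

/-- Away from the ends this is the Lipschitz bound at the nearest grid point. Near 0 or 1 that point
is clamped and may be farther than 1/(2N), but moving x towards all the grid heights can only lower
the kernel. -/
lemma kernelA_grid_left_le (m : ℕ) (hN : 2 ≤ N) {x : ℝ} (hx : 0 ≤ x) :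
    ∃ i, ∀ j, kernelA (m + 1) (gridPoint N i) (gridPoint N j)
      ≤ kernelA (m + 1) x (gridPoint N j) + m / (2 * N) := by
  have hN0 : (0 : ℝ) < N := by norm_cast; omega
  have hε : (0 : ℝ) ≤ m / (2 * N) := by positivity
  refine ⟨floorIndex N hN (x * N + 1 / 2), fun j => ?_⟩
  set i := floorIndex N hN (x * N + 1 / 2) with hi
  have hi0 := (gridPoint_pos hN i).le
  have hi1 := (gridPoint_lt_one hN i).le
  have hj0 := (gridPoint_pos hN j).le
  have hj1 := (gridPoint_lt_one hN j).le
  have hlip := kernelA_lipschitz_left m hi0 hi1 hx hj0 hj1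
  rcases lt_or_ge (x * N + 1 / 2) 1 with h1 | h1
  · have e := gridPoint_floorIndex_of_lt_one hN h1
    have hxi : x ≤ gridPoint N i := le_of_mul_le_mul_right (by linarith) hN0
    have hij : gridPoint N i ≤ gridPoint N j :=
      le_of_mul_le_mul_right (by linarith [one_le_gridPoint_mul hN j]) hN0
    linarith [kernelA_le_of_ge m hx hj1 hxi hij]
  rcases lt_or_ge (x * N + 1 / 2) N with h2 | h2
  · have e := abs_sub_gridPoint_le hN h1 h2
    rw [abs_sub_comm] at e
    have := mul_le_mul_of_nonneg_left e (m.cast_nonneg (α := ℝ))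
    rw [mul_one_div] at this
    linarith
  · have e := gridPoint_floorIndex_of_ge hN h2
    have hxi : gridPoint N i ≤ x := le_of_mul_le_mul_right (by linarith) hN0
    have hij : gridPoint N j ≤ gridPoint N i :=
      le_of_mul_le_mul_right (by linarith [gridPoint_mul_le hN j]) hN0
    linarith [kernelA_le_of_le m hj0 hij hxi]

/-- Near the ends, y is compared with 0 or 1 instead of a grid point: the kernel vanishes there and
is nonnegative at the clamped grid point. -/
lemma kernelA_le_grid_right (m : ℕ) (hm : 1 ≤ m) (hN : 2 ≤ N) {y : ℝ} (hy : 0 ≤ y) (hy1 : y ≤ 1)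
    (i : Fin (N - 1)) :
    kernelA (m + 1) (gridPoint N i) y ≤ kernelA (m + 1) (gridPoint N i)
      (gridPoint N (floorIndex N hN (y * N + 1 / 2))) + m / (2 * N) := by
  have hN0 : (0 : ℝ) < N := by norm_cast; omega
  set j := floorIndex N hN (y * N + 1 / 2) with hj
  have hi0 := (gridPoint_pos hN i).le
  have hi1 := (gridPoint_lt_one hN i).le
  have hj0 := (gridPoint_pos hN j).le
  have hj1 := (gridPoint_lt_one hN j).le
  have hnn := kernelA_nonneg m hi0 hj0 hj1
  have hm0 : (0 : ℝ) ≤ m := m.cast_nonneg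
  have hlip : ∀ y' : ℝ, 0 ≤ y' → y' ≤ 1 → |y - y'| ≤ 1 / (2 * N) →
      kernelA (m + 1) (gridPoint N i) y ≤ kernelA (m + 1) (gridPoint N i) y' + m / (2 * N) := by
    intro y' h0 h1 h
    have e1 := le_of_abs_le (kernelA_lipschitz_right m hm hi0 hi1 hy hy1 h0 h1)
    have e2 := mul_le_mul_of_nonneg_left h hm0
    rw [mul_one_div] at e2
    linarith
  have hbd : ∀ t : ℝ, t * N ≤ 1 / 2 → t ≤ 1 / (2 * N) := by
    intro t ht
    refine le_of_mul_le_mul_right ?_ hN0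
    have : 1 / (2 * (N : ℝ)) * N = 1 / 2 := by field_simp
    linarith
  rcases lt_or_ge (y * N + 1 / 2) 1 with h1 | h1
  · have := hlip 0 le_rfl zero_le_one (by
      rw [sub_zero, abs_of_nonneg hy]; exact hbd _ (by linarith))
    rw [kernelA_zero_right m hi0] at this
    linarith
  rcases lt_or_ge (y * N + 1 / 2) N with h2 | h2
  · exact hlip _ hj0 hj1 (abs_sub_gridPoint_le hN h1 h2)
  · have := hlip 1 zero_le_one le_rfl (by
      rw [abs_sub_comm, abs_of_nonneg (sub_nonneg.2 hy1)]; exact hbd _ (by linarith))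
    rw [kernelA_one_right m hi1] at this
    linarith

/-- Rounding x down is free above the diagonal, where the reward decreases in x. Below it, the
geometric sum grows by at most m/N times `geomSum (m + 1) y` at the grid height y, and the factor 1
- y turns this into the prophet's integrand. No grid height separates x from its rounding. -/
lemma rewardKernel_le_grid_left (m : ℕ) (hN : 2 ≤ N) {x : ℝ} (hx : 0 ≤ x) :
    ∃ i, ∀ j, rewardKernel (m + 1) x (gridPoint N j)
      ≤ rewardKernel (m + 1) (gridPoint N i) (gridPoint N j)
        + m / N * (1 - gridPoint N j ^ (m + 1)) := by
  have hN0 : (0 : ℝ) < N := by norm_cast; omega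
  have hm0 : (0 : ℝ) ≤ m := m.cast_nonneg
  refine ⟨floorIndex N hN (x * N), fun j => ?_⟩
  set i := floorIndex N hN (x * N) with hi
  have hi0 := (gridPoint_pos hN i).le
  have hi1 := (gridPoint_lt_one hN i).le
  have hj0 := (gridPoint_pos hN j).le
  have hj1 := (gridPoint_lt_one hN j).le
  have hε : (0 : ℝ) ≤ m / N * (1 - gridPoint N j ^ (m + 1)) :=
    mul_nonneg (by positivity) (sub_nonneg.2 (pow_le_one₀ hj0 hj1))
  have hdec : gridPoint N j ≤ gridPoint N i → gridPoint N i ≤ x →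
      rewardKernel (m + 1) x (gridPoint N j)
        ≤ rewardKernel (m + 1) (gridPoint N i) (gridPoint N j) := by
    intro h1 h2
    rw [rewardKernel_of_le m h1, rewardKernel_of_le m (h1.trans h2)]
    have := mul_le_mul_of_nonneg_right (pow_le_pow_left₀ hi0 h2 m) hj0
    linarith
  -- Below 1/N the clamping rounds x up, which is free because the reward increases in x below every
  -- grid height.
  rcases lt_or_ge (x * N) 1 with h1 | h1
  · have e := gridPoint_floorIndex_of_lt_one hN h1
    have hxi : x ≤ gridPoint N i := le_of_mul_le_mul_right (by linarith) hN0
    have hij : gridPoint N i ≤ gridPoint N j :=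
      le_of_mul_le_mul_right (by linarith [one_le_gridPoint_mul hN j]) hN0
    rw [rewardKernel_of_ge m hij, rewardKernel_of_ge m (hxi.trans hij)]
    have := mul_le_mul_of_nonneg_left (geomSum_mono (m + 1) hx hxi) (sub_nonneg.2 hj1)
    linarith
  have hxi : gridPoint N i ≤ x :=
    le_of_mul_le_mul_right (gridPoint_floorIndex_mul_le hN h1) hN0
  rcases lt_or_ge (x * N) N with h2 | h2
  · have e := lt_gridPoint_floorIndex_mul hN h2
    rcases gridPoint_le_or_ge hN j i e with h | h
    · linarith [hdec h hxi]
    · rw [rewardKernel_of_ge m h, rewardKernel_of_ge m (hxi.trans h), ← geomSum_mul]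
      have hd : (m : ℝ) * (x - gridPoint N i) ≤ m / N := by
        rw [le_div_iff₀ hN0, mul_assoc]
        exact mul_le_of_le_one_right hm0 (by linarith)
      have h3 : geomSum (m + 1) x - geomSum (m + 1) (gridPoint N i)
          ≤ m / N * geomSum (m + 1) (gridPoint N j) :=
        (geomSum_succ_sub_le' m hi0 hxi).trans
          (mul_le_mul hd (geomSum_mono _ hx h) (geomSum_nonneg _ hx) (by positivity))
      have := mul_le_mul_of_nonneg_right h3 (sub_nonneg.2 hj1)
      linarith
  · have e := gridPoint_floorIndex_of_ge hN h2
    have hij : gridPoint N j ≤ gridPoint N i :=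
      le_of_mul_le_mul_right (by linarith [gridPoint_mul_le hN j]) hN0
    linarith [hdec hij hxi]

/-- The ratio kernel does not grow by more than `m * (y - y')` when its second argument `y` is
replaced by a smaller `y'`, if `x` does not lie between the two. -/
lemma rewardKernel_div_le (m : ℕ) {x y y' : ℝ} (hx : 0 ≤ x) (hx1 : x ≤ 1) (hy' : 0 ≤ y')
    (h : y' ≤ y) (hy : y < 1) (hxy : x ≤ y' ∨ y ≤ x) :
    rewardKernel (m + 1) x y' / (1 - y' ^ (m + 1))
      ≤ rewardKernel (m + 1) x y / (1 - y ^ (m + 1)) + m * (y - y') := by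
  have hy0 : 0 ≤ y := hy'.trans h
  have hd : 0 < 1 - y := sub_pos.2 hy
  have hd' : 0 < 1 - y' := sub_pos.2 (h.trans_lt hy)
  have hG : 1 ≤ geomSum (m + 1) y := one_le_geomSum_succ m hy0
  have hG' : 1 ≤ geomSum (m + 1) y' := one_le_geomSum_succ m hy'
  have hGpos : 0 < geomSum (m + 1) y := one_pos.trans_le hG
  have hGpos' : 0 < geomSum (m + 1) y' := one_pos.trans_le hG'
  have hc : 0 ≤ (m : ℝ) * (y - y') := mul_nonneg m.cast_nonneg (sub_nonneg.2 h)
  -- The relative growth of the geometric sum is at most m (y - y'), which bounds the decrease of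
  -- its reciprocal.
  have key : 1 / geomSum (m + 1) y' - 1 / geomSum (m + 1) y
      ≤ m * (y - y') / geomSum (m + 1) y' := by
    rw [div_sub_div _ _ hGpos'.ne' hGpos.ne', div_le_div_iff₀ (by positivity) hGpos']
    have := mul_le_mul_of_nonneg_right (geomSum_succ_sub_le' m hy' h) hGpos'.le
    linarith
  rcases hxy with hx' | hx'
  · have hGx := geomSum_nonneg (m + 1) hx
    have hGx' := geomSum_mono (m + 1) hx hx'
    rw [rewardKernel_of_ge m hx', rewardKernel_of_ge m (hx'.trans h), ← geomSum_mul, ← geomSum_mul]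
    have e1 : (1 - y') * geomSum (m + 1) x / (geomSum (m + 1) y' * (1 - y'))
        = geomSum (m + 1) x * (1 / geomSum (m + 1) y') := by field_simp
    have e2 : (1 - y) * geomSum (m + 1) x / (geomSum (m + 1) y * (1 - y))
        = geomSum (m + 1) x * (1 / geomSum (m + 1) y) := by field_simp
    rw [e1, e2, ← sub_le_iff_le_add', ← mul_sub]
    calc _ ≤ geomSum (m + 1) x * (m * (y - y') / geomSum (m + 1) y') :=
          mul_le_mul_of_nonneg_left key hGx
      _ = m * (y - y') * (geomSum (m + 1) x / geomSum (m + 1) y') := by ring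
      _ ≤ m * (y - y') * 1 := by
          refine mul_le_mul_of_nonneg_left ?_ hc
          exact (div_le_one hGpos').2 hGx'
      _ = _ := mul_one _
  · set w := x ^ m with hw
    have hw0 : 0 ≤ w := pow_nonneg hx m
    have hw1 : w ≤ 1 := pow_le_one₀ hx hx1
    have hD : 0 < 1 - y ^ (m + 1) := by rw [← geomSum_mul]; positivity
    have hD' : 0 < 1 - y' ^ (m + 1) := by rw [← geomSum_mul]; positivity
    -- From 1 - w t = (1 - w) + w (1 - t). The first term increases in t, so only the reciprocal
    -- geometric sum can decrease as t grows.
    have e : ∀ t : ℝ, 1 - t ≠ 0 → geomSum (m + 1) t ≠ 0 → (1 - w * t) / (1 - t ^ (m + 1))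
        = (1 - w) * (1 / (1 - t ^ (m + 1))) + w * (1 / geomSum (m + 1) t) := by
      intro t ht hGt
      rw [← geomSum_mul]
      field_simp
      ring
    rw [rewardKernel_of_le m hx', rewardKernel_of_le m (h.trans hx'), e y hd.ne' hGpos.ne',
      e y' hd'.ne' hGpos'.ne']
    have h1 : 1 / (1 - y' ^ (m + 1)) ≤ 1 / (1 - y ^ (m + 1)) :=
      one_div_le_one_div_of_le hD (by linarith [pow_le_pow_left₀ hy' h (m + 1)])
    have h2 := mul_le_mul_of_nonneg_left h1 (sub_nonneg.2 hw1)
    have h3 : 1 / geomSum (m + 1) y' - 1 / geomSum (m + 1) y ≤ m * (y - y') :=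
      key.trans (div_le_self hc hG')
    have h4 := mul_le_mul_of_nonneg_left h3 hw0
    have h5 := mul_le_mul_of_nonneg_right hw1 hc
    linarith

/-- Multiplying through by 1 - y^(m+1) keeps the estimate meaningful at y = 1, where the ratio is
undefined. -/
lemma grid_right_le_rewardKernel (m : ℕ) (hm : 1 ≤ m) (hN : 2 ≤ N) {y : ℝ} (hy : 0 ≤ y)
    (hy1 : y ≤ 1) (i : Fin (N - 1)) :
    (kernelR (m + 1) (gridPoint N i) (gridPoint N (floorIndex N hN (y * N))) - m / N)
        * (1 - y ^ (m + 1)) ≤ rewardKernel (m + 1) (gridPoint N i) y := by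
  have hN0 : (0 : ℝ) < N := by norm_cast; omega
  have hm0 : (0 : ℝ) ≤ m := m.cast_nonneg
  have hm1 : (1 : ℝ) ≤ m := by exact_mod_cast hm
  have hi0 := (gridPoint_pos hN i).le
  have hi1 := gridPoint_lt_one hN i
  rcases hy1.eq_or_lt with rfl | hy1'
  · simpa using rewardKernel_nonneg (m + 1) hi0 hi1.le le_rfl
  set j := floorIndex N hN (y * N) with hj
  have hj0 := (gridPoint_pos hN j).le
  have hj1 := gridPoint_lt_one hN j
  have hD : 0 < 1 - y ^ (m + 1) := sub_pos.2 (pow_lt_one₀ hy hy1' (by simp))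
  have hDj : 0 < 1 - gridPoint N j ^ (m + 1) := sub_pos.2 (pow_lt_one₀ hj0 hj1 (by simp))
  rw [kernelR_eq m hi1 hj0 hj1]
  -- Here y is rounded up, so the one-sided estimate is unavailable. Instead the grid ratio is at
  -- most 1, while the reward is at least 1 - y ≥ 1 - m/N.
  rcases lt_or_ge (y * N) 1 with h1 | h1
  · have hyi : y ≤ gridPoint N i :=
      le_of_mul_le_mul_right (by linarith [one_le_gridPoint_mul hN i]) hN0
    have e1 : rewardKernel (m + 1) (gridPoint N i) (gridPoint N j) / (1 - gridPoint N j ^ (m + 1))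
        ≤ 1 := (div_le_one hDj).2 (rewardKernel_le m hi0 hj0 hj1.le)
    have e2 : y ≤ m / N := by
      rw [le_div_iff₀ hN0]
      linarith
    have e3 : gridPoint N i ^ m * y ≤ y := mul_le_of_le_one_left hy (pow_le_one₀ hi0 hi1.le)
    rw [rewardKernel_of_le m hyi]
    have e4 : (rewardKernel (m + 1) (gridPoint N i) (gridPoint N j) /
        (1 - gridPoint N j ^ (m + 1)) - m / N) * (1 - y ^ (m + 1))
        ≤ (1 - y) * (1 - y ^ (m + 1)) := mul_le_mul_of_nonneg_right (by linarith) hD.le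
    have e5 : (1 - y) * (1 - y ^ (m + 1)) ≤ 1 - y :=
      mul_le_of_le_one_right (sub_nonneg.2 hy1) (by linarith [pow_nonneg hy (m + 1)])
    linarith
  · have e1 : gridPoint N j ≤ y :=
      le_of_mul_le_mul_right (gridPoint_floorIndex_mul_le hN h1) hN0
    have e2 : y * N < gridPoint N j * N + 1 :=
      lt_gridPoint_floorIndex_mul hN (by nlinarith)
    have hd : (m : ℝ) * (y - gridPoint N j) ≤ m / N := by
      rw [le_div_iff₀ hN0, mul_assoc]
      exact mul_le_of_le_one_right hm0 (by linarith)
    have e3 := rewardKernel_div_le m hi0 hi1.le hj0 e1 hy1' (gridPoint_le_or_ge hN i j e2)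
    rw [← le_div_iff₀ hD]
    linarith

end

/-! ## Comparison of the games -/

section

section Simplex

variable {k : ℕ}

lemma stdSimplex_dotProduct_le (l : stdSimplex ℝ (Fin k)) {v : Fin k → ℝ} {C : ℝ}
    (h : ∀ i, v i ≤ C) : (l : Fin k → ℝ) ⬝ᵥ v ≤ C := by
  calc (l : Fin k → ℝ) ⬝ᵥ v ≤ ∑ i, (l : Fin k → ℝ) i * C :=
        Finset.sum_le_sum fun i _ => mul_le_mul_of_nonneg_left (h i) (l.2.1 i)
    _ = C := by rw [← Finset.sum_mul, stdSimplex.sum_eq_one, one_mul]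

lemma le_stdSimplex_dotProduct (l : stdSimplex ℝ (Fin k)) {v : Fin k → ℝ} {C : ℝ}
    (h : ∀ i, C ≤ v i) : C ≤ (l : Fin k → ℝ) ⬝ᵥ v := by
  calc C = ∑ i, (l : Fin k → ℝ) i * C := by rw [← Finset.sum_mul, stdSimplex.sum_eq_one, one_mul]
    _ ≤ (l : Fin k → ℝ) ⬝ᵥ v :=
        Finset.sum_le_sum fun i _ => mul_le_mul_of_nonneg_left (h i) (l.2.1 i)

lemma apply_le_iSup_dotProduct (v : Fin k → ℝ) (i : Fin k) :
    v i ≤ ⨆ l : stdSimplex ℝ (Fin k), (l : Fin k → ℝ) ⬝ᵥ v := by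
  have hb : BddAbove (Set.range fun l : stdSimplex ℝ (Fin k) => (l : Fin k → ℝ) ⬝ᵥ v) := by
    refine ⟨∑ j, |v j|, ?_⟩
    rintro _ ⟨l, rfl⟩
    exact stdSimplex_dotProduct_le l fun j => (le_abs_self _).trans
      (Finset.single_le_sum (f := fun j => |v j|) (fun _ _ => abs_nonneg _) (Finset.mem_univ j))
  have := le_ciSup hb ⟨Pi.single i 1, single_mem_stdSimplex ℝ i⟩
  simpa using this

lemma iInf_dotProduct_le_apply (v : Fin k → ℝ) (i : Fin k) :
    ⨅ l : stdSimplex ℝ (Fin k), (l : Fin k → ℝ) ⬝ᵥ v ≤ v i := by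
  have hb : BddBelow (Set.range fun l : stdSimplex ℝ (Fin k) => (l : Fin k → ℝ) ⬝ᵥ v) := by
    refine ⟨-∑ j, |v j|, ?_⟩
    rintro _ ⟨l, rfl⟩
    refine le_stdSimplex_dotProduct l fun j => (neg_le_neg ?_).trans (neg_abs_le (v j))
    exact Finset.single_le_sum (f := fun j => |v j|) (fun _ _ => abs_nonneg _) (Finset.mem_univ j)
  have := ciInf_le hb ⟨Pi.single i 1, single_mem_stdSimplex ℝ i⟩
  simpa using this

end Simplex

variable {N : ℕ}

instance : Nonempty ThresholdRule := ⟨⟨0, 0⟩⟩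

lemma matrixA_mulVec (n : ℕ) (v : Fin (N - 1) → ℝ) (i : Fin (N - 1)) :
    (matrixA n N *ᵥ v) i = ∑ j, kernelA n (gridPoint N i) (gridPoint N j) * v j :=
  rfl

lemma matrixR_mulVec (n : ℕ) (v : Fin (N - 1) → ℝ) (i : Fin (N - 1)) :
    (matrixR n N *ᵥ v) i = ∑ j, kernelR n (gridPoint N i) (gridPoint N j) * v j :=
  rfl

lemma nonempty_stdSimplex_grid (hN : 2 ≤ N) : Nonempty (stdSimplex ℝ (Fin (N - 1))) :=
  ⟨⟨Pi.single ⟨0, by omega⟩ 1, single_mem_stdSimplex ℝ _⟩⟩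

/-- Any weights on the grid are the times that some distribution function spends at the heights
of the grid. -/
lemma exists_law_integral_comp_cdf (hN : 2 ≤ N) {v : Fin (N - 1) → ℝ} (hv : ∀ j, 0 ≤ v j) :
    ∃ F : ProbabilityMeasure ℝ, (∀ᵐ x ∂(F : Measure ℝ), x ∈ Set.Icc 0 (∑ j, v j)) ∧
      Integrable (fun x : ℝ => x) (F : Measure ℝ) ∧ ∀ g : ℝ → ℝ, g 1 = 0 →
        ∫ t in Set.Ioi (0 : ℝ), g (cdf (F : Measure ℝ) t) = ∑ j, v j * g (gridPoint N j) := by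
  set w : ℕ → ℝ := fun i => if h : i < N - 1 then v ⟨i, h⟩ else 0 with hw
  have hw0 : ∀ i, 0 ≤ w i := fun i => by
    simp only [hw]
    split_ifs
    exacts [hv _, le_rfl]
  have hwv : ∀ j : Fin (N - 1), w j = v j := fun j => by simp [hw]
  refine ⟨partialSumLaw N (by omega) w, ?_, integrable_partialSumMeasure N w, fun g hg => ?_⟩
  · refine ae_partialSumMeasure measurableSet_Icc fun j hj =>
      ⟨Finset.sum_nonneg fun i _ => hw0 i, ?_⟩
    calc ∑ i ∈ Finset.range j, w i ≤ ∑ i ∈ Finset.range (N - 1), w i :=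
          Finset.sum_le_sum_of_subset_of_nonneg (Finset.range_mono (by omega)) fun i _ _ => hw0 i
      _ = ∑ j, v j := by
          rw [Finset.sum_range]
          exact Finset.sum_congr rfl fun j _ => hwv j
  · rw [integral_comp_cdf_partialSumLaw N _ hw0 hg, Finset.sum_range]
    exact Finset.sum_congr rfl fun j _ => by rw [hwv, gridPoint]

variable {F : ProbabilityMeasure ℝ}

/-! ### Integrability and a priori bounds -/

lemma one_sub_pow_le (m : ℕ) {y : ℝ} (hy : 0 ≤ y) (hy1 : y ≤ 1) :
    1 - y ^ (m + 1) ≤ (m + 1 : ℝ) * (1 - y) := by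
  rw [← geomSum_mul]
  exact mul_le_mul_of_nonneg_right (by exact_mod_cast geomSum_le (m + 1) hy hy1)
    (sub_nonneg.2 hy1)

lemma integrableOn_one_sub_cdf_pow (m : ℕ) (hF : ∀ᵐ x ∂(F : Measure ℝ), 0 ≤ x)
    (hi : Integrable (fun x : ℝ => x) (F : Measure ℝ)) :
    IntegrableOn (fun s => 1 - cdf (F : Measure ℝ) s ^ (m + 1)) (Set.Ioi (0 : ℝ)) := by
  refine integrableOn_comp_cdf (g := fun y => 1 - y ^ (m + 1)) hF hi (by fun_prop) (m + 1)
    fun y hy hy1 => ?_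
  rw [abs_of_nonneg (sub_nonneg.2 (pow_le_one₀ hy hy1))]
  exact one_sub_pow_le m hy hy1

lemma measurable_rewardKernel (n : ℕ) (x : ℝ) : Measurable (rewardKernel n x) := by
  unfold rewardKernel
  fun_prop

lemma integrableOn_rewardKernel (m : ℕ) (hF : ∀ᵐ x ∂(F : Measure ℝ), 0 ≤ x)
    (hi : Integrable (fun x : ℝ => x) (F : Measure ℝ)) {x : ℝ} (hx : 0 ≤ x) (hx1 : x ≤ 1) :
    IntegrableOn (fun s => rewardKernel (m + 1) x (cdf (F : Measure ℝ) s)) (Set.Ioi (0 : ℝ)) := by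
  refine integrableOn_comp_cdf hF hi (measurable_rewardKernel _ x) (m + 1) fun y hy hy1 => ?_
  rw [abs_of_nonneg (rewardKernel_nonneg _ hx hx1 hy1)]
  exact (rewardKernel_le m hx hy hy1).trans (one_sub_pow_le m hy hy1)

lemma integrableOn_kernelA (m : ℕ) (hF : ∀ᵐ x ∂(F : Measure ℝ), 0 ≤ x)
    (hi : Integrable (fun x : ℝ => x) (F : Measure ℝ)) {x : ℝ} (hx : 0 ≤ x) (hx1 : x ≤ 1) :
    IntegrableOn (fun s => kernelA (m + 1) x (cdf (F : Measure ℝ) s)) (Set.Ioi (0 : ℝ)) := by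
  simp_rw [kernelA_eq]
  exact (integrableOn_one_sub_cdf_pow m hF hi).sub (integrableOn_rewardKernel m hF hi hx hx1)

lemma regret_eq (m : ℕ) (hF : ∀ᵐ x ∂(F : Measure ℝ), 0 ≤ x)
    (hi : Integrable (fun x : ℝ => x) (F : Measure ℝ)) (τ : ThresholdRule) :
    regret (m + 1) τ F
      = ∫ s in Set.Ioi (0 : ℝ), kernelA (m + 1) (rejectProb τ F) (cdf (F : Measure ℝ) s) := by
  simp_rw [kernelA_eq]
  rw [regret, reward_eq m hF hi, prophetValue_eq m hF hi, integral_sub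
    (integrableOn_one_sub_cdf_pow m hF hi)
    (integrableOn_rewardKernel m hF hi (rejectProb_nonneg τ F) (rejectProb_le_one τ F))]

lemma regret_nonneg (m : ℕ) (hF : ∀ᵐ x ∂(F : Measure ℝ), 0 ≤ x)
    (hi : Integrable (fun x : ℝ => x) (F : Measure ℝ)) (τ : ThresholdRule) :
    0 ≤ regret (m + 1) τ F := by
  rw [regret_eq m hF hi]
  exact integral_nonneg fun s =>
    kernelA_nonneg m (rejectProb_nonneg τ F) (cdf_nonneg _ s) (cdf_le_one _ s)

lemma reward_nonneg (m : ℕ) (hF : ∀ᵐ x ∂(F : Measure ℝ), 0 ≤ x)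
    (hi : Integrable (fun x : ℝ => x) (F : Measure ℝ)) (τ : ThresholdRule) :
    0 ≤ reward (m + 1) τ F := by
  rw [reward_eq m hF hi]
  exact integral_nonneg fun s =>
    rewardKernel_nonneg _ (rejectProb_nonneg τ F) (rejectProb_le_one τ F) (cdf_le_one _ s)

lemma prophetValue_pos (m : ℕ) (hF : F ∈ distNonneg) : 0 < prophetValue (m + 1) F := by
  obtain ⟨hnn, hi, hne⟩ := hF
  have h1 : 0 < ∫ x, x ∂(F : Measure ℝ) := by
    refine lt_of_le_of_ne (integral_nonneg_of_ae hnn) fun h => hne ?_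
    exact (integral_eq_zero_iff_of_nonneg_ae hnn hi).1 h.symm
  rw [integral_id_eq hnn hi] at h1
  rw [prophetValue_eq m hnn hi]
  refine h1.trans_le (integral_mono (integrable_one_sub_cdf hnn hi)
    (integrableOn_one_sub_cdf_pow m hnn hi) fun s => ?_)
  have := pow_le_of_le_one (cdf_nonneg (F : Measure ℝ) s) (cdf_le_one _ s) m.succ_ne_zero
  exact sub_le_sub_left this 1

lemma competitiveRatio_nonneg (m : ℕ) (hF : F ∈ distNonneg) (τ : ThresholdRule) :
    0 ≤ competitiveRatio (m + 1) τ F :=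
  div_nonneg (reward_nonneg m hF.1 hF.2.1 τ) (prophetValue_pos m hF).le

lemma competitiveRatio_le_one (m : ℕ) (hF : F ∈ distNonneg) (τ : ThresholdRule) :
    competitiveRatio (m + 1) τ F ≤ 1 := by
  rw [competitiveRatio, div_le_one (prophetValue_pos m hF)]
  have := regret_nonneg m hF.1 hF.2.1 τ
  rw [regret] at this
  linarith

lemma cdf_eq_one_of_ae_le {a s : ℝ} (h : ∀ᵐ x ∂(F : Measure ℝ), x ≤ a) (hs : a ≤ s) :
    cdf (F : Measure ℝ) s = 1 := by
  have h1 : (F : Measure ℝ) (Set.Iic s) = 1 := by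
    rw [prob_compl_eq_zero_iff measurableSet_Iic |>.symm, measure_eq_zero_iff_ae_notMem]
    filter_upwards [h] with x hx
    simpa using hx.trans hs
  rw [cdf_eq_real, measureReal_def, h1, ENNReal.toReal_one]

lemma prophetValue_eq_zero (m : ℕ) (h : ∀ᵐ x ∂(F : Measure ℝ), x = 0)
    (hi : Integrable (fun x : ℝ => x) (F : Measure ℝ)) : prophetValue (m + 1) F = 0 := by
  rw [prophetValue_eq m (h.mono fun x hx => hx.ge) hi]
  refine setIntegral_eq_zero_of_forall_eq_zero fun s (hs : 0 < s) => ?_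
  rw [cdf_eq_one_of_ae_le (h.mono fun x hx => hx.le) hs.le, one_pow, sub_self]

lemma integrable_of_mem_distUnitInterval (hF : F ∈ distUnitInterval) :
    Integrable (fun x : ℝ => x) (F : Measure ℝ) := by
  refine (integrable_const (1 : ℝ)).mono' aestronglyMeasurable_id ?_
  filter_upwards [hF] with x hx
  exact (Real.norm_of_nonneg hx.1).trans_le hx.2

lemma ae_nonneg_of_mem_distUnitInterval (hF : F ∈ distUnitInterval) :
    ∀ᵐ x ∂(F : Measure ℝ), 0 ≤ x :=
  Filter.Eventually.mono hF fun _ hx => hx.1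

/-- Levels s ≥ 1 contribute nothing because the kernel vanishes at y = 1. The remaining interval has
length 1, so the values of F(s) carry a probability distribution. -/
lemma regret_eq_of_mem_distUnitInterval (m : ℕ) (hF : F ∈ distUnitInterval) (τ : ThresholdRule) :
    regret (m + 1) τ F
      = ∫ s in Set.Ioc (0 : ℝ) 1, kernelA (m + 1) (rejectProb τ F) (cdf (F : Measure ℝ) s) := by
  rw [regret_eq m (ae_nonneg_of_mem_distUnitInterval hF) (integrable_of_mem_distUnitInterval hF)]
  refine setIntegral_eq_of_subset_of_forall_sdiff_eq_zero measurableSet_Ioi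
    Set.Ioc_subset_Ioi_self fun s hs => ?_
  have hs1 : 1 ≤ s := le_of_lt (by simpa [hs.1.out] using hs.2)
  rw [cdf_eq_one_of_ae_le (Filter.Eventually.mono hF fun _ hx => hx.2) hs1]
  exact kernelA_one_right m (rejectProb_le_one τ F)

lemma kernelA_le_one (m : ℕ) {x y : ℝ} (hx : 0 ≤ x) (hx1 : x ≤ 1) (hy : 0 ≤ y) (hy1 : y ≤ 1) :
    kernelA (m + 1) x y ≤ 1 := by
  rw [kernelA_eq]
  linarith [rewardKernel_nonneg (m + 1) hx hx1 hy1, pow_nonneg hy (m + 1)]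

lemma regret_le_one (m : ℕ) (hF : F ∈ distUnitInterval) (τ : ThresholdRule) :
    regret (m + 1) τ F ≤ 1 := by
  rw [regret_eq_of_mem_distUnitInterval m hF]
  calc _ ≤ ∫ _ in Set.Ioc (0 : ℝ) 1, (1 : ℝ) := by
        refine integral_mono ((integrableOn_kernelA m (ae_nonneg_of_mem_distUnitInterval hF)
          (integrable_of_mem_distUnitInterval hF) (rejectProb_nonneg τ F)
          (rejectProb_le_one τ F)).mono_set Set.Ioc_subset_Ioi_self)
          (integrable_const _) fun s => ?_
        exact kernelA_le_one m (rejectProb_nonneg τ F) (rejectProb_le_one τ F) (cdf_nonneg _ s)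
          (cdf_le_one _ s)
    _ = 1 := by simp

lemma bddBelow_regret (m : ℕ) (hF : F ∈ distUnitInterval) :
    BddBelow (Set.range fun τ => regret (m + 1) τ F) := by
  refine ⟨0, ?_⟩
  rintro _ ⟨τ, rfl⟩
  exact regret_nonneg m (ae_nonneg_of_mem_distUnitInterval hF)
    (integrable_of_mem_distUnitInterval hF) τ

/-- Nature's mixed strategy on the grid is realized exactly, by a law supported in [0,1] because the
weights sum to 1. Only the rejection probability is rounded. -/
lemma matrixValueA_sub_le (m : ℕ) (hN : 2 ≤ N) :
    matrixValueA (m + 1) N - m / (2 * N) ≤ worstCaseRegret (m + 1) distUnitInterval := by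
  have := nonempty_stdSimplex_grid hN
  rw [sub_le_iff_le_add, matrixValueA]
  refine ciSup_le fun μ => ?_
  rw [← sub_le_iff_le_add]
  obtain ⟨F, hF, hi, hint⟩ := exists_law_integral_comp_cdf hN μ.2.1
  rw [μ.2.2] at hF
  have hmem : F ∈ distUnitInterval := hF
  have hbdd : BddAbove (Set.range fun F : distUnitInterval =>
      ⨅ τ : ThresholdRule, regret (m + 1) τ F) := by
    refine ⟨1, ?_⟩
    rintro _ ⟨G, rfl⟩
    exact (ciInf_le (bddBelow_regret m G.2) ⟨0, 0⟩).trans (regret_le_one m G.2 _)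
  refine le_trans ?_ (le_ciSup hbdd ⟨F, hmem⟩)
  refine le_ciInf fun τ => ?_
  obtain ⟨i, hle⟩ := kernelA_grid_left_le m hN (rejectProb_nonneg τ F)
  simp only
  rw [regret_eq m (ae_nonneg_of_mem_distUnitInterval hmem) hi,
    hint _ (kernelA_one_right m (rejectProb_le_one τ F))]
  refine (sub_le_sub_right (iInf_dotProduct_le_apply _ i) _).trans ?_
  rw [sub_le_iff_le_add]
  calc (matrixA (m + 1) N *ᵥ (μ : Fin (N - 1) → ℝ)) i
      = ∑ j, (μ : Fin (N - 1) → ℝ) j * kernelA (m + 1) (gridPoint N i) (gridPoint N j) := by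
        rw [matrixA_mulVec]
        exact Finset.sum_congr rfl fun j _ => mul_comm _ _
    _ ≤ ∑ j, (μ : Fin (N - 1) → ℝ) j *
          (kernelA (m + 1) (rejectProb τ F) (gridPoint N j) + m / (2 * N)) :=
        Finset.sum_le_sum fun j _ => mul_le_mul_of_nonneg_left (hle j) (μ.2.1 j)
    _ = _ := by
        simp_rw [mul_add]
        rw [Finset.sum_add_distrib, ← Finset.sum_mul, stdSimplex.sum_eq_one, one_mul]
        rfl

/-- Nature's matrix strategy is the distribution of the rounded F(s) for s uniform on (0,1]. Grid
rejection probabilities are attained exactly, so only y is rounded. -/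
lemma worstCaseRegret_le (m : ℕ) (hm : 1 ≤ m) (hN : 2 ≤ N) :
    worstCaseRegret (m + 1) distUnitInterval ≤ matrixValueA (m + 1) N + m / (2 * N) := by
  have hsimplex := nonempty_stdSimplex_grid hN
  have hne : Nonempty distUnitInterval := by
    obtain ⟨μ⟩ := hsimplex
    obtain ⟨F, hF, -⟩ := exists_law_integral_comp_cdf hN μ.2.1
    rw [μ.2.2] at hF
    exact ⟨⟨F, hF⟩⟩
  refine ciSup_le fun ⟨F, hF⟩ => ?_
  have hnn := ae_nonneg_of_mem_distUnitInterval hF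
  have hi := integrable_of_mem_distUnitInterval hF
  set r : ℝ → Fin (N - 1) := fun s => floorIndex N hN (cdf (F : Measure ℝ) s * N + 1 / 2) with hr
  have hrm : Measurable r := (measurable_floorIndex N hN).comp
    (((monotone_cdf (F : Measure ℝ)).measurable.mul_const _).add_const _)
  set κ : Measure ℝ := volume.restrict (Set.Ioc (0 : ℝ) 1) with hκ
  have h1 : Integrable (fun _ : ℝ => (1 : ℝ)) κ := integrable_const _
  have hgroup := sum_integral_indicator_mul hrm h1
  have hμ : (fun j => ∫ s, (r ⁻¹' {j}).indicator (fun _ => (1 : ℝ)) s ∂κ)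
      ∈ stdSimplex ℝ (Fin (N - 1)) := by
    refine ⟨fun j => integral_nonneg fun s => Set.indicator_nonneg (fun _ _ => zero_le_one) s, ?_⟩
    have := hgroup fun _ => 1
    simp only [one_mul] at this
    rw [this]
    simp [hκ]
  have hbdd : BddAbove (Set.range fun μ : stdSimplex ℝ (Fin (N - 1)) =>
      ⨅ l : stdSimplex ℝ (Fin (N - 1)),
        (l : Fin (N - 1) → ℝ) ⬝ᵥ (matrixA (m + 1) N *ᵥ (μ : Fin (N - 1) → ℝ))) := by
    refine ⟨1, ?_⟩
    rintro _ ⟨μ, rfl⟩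
    refine (iInf_dotProduct_le_apply _ ⟨0, by omega⟩).trans ?_
    rw [Matrix.mulVec, dotProduct_comm]
    exact stdSimplex_dotProduct_le μ fun j => kernelA_le_one m (gridPoint_pos hN _).le
      (gridPoint_lt_one hN _).le (gridPoint_pos hN _).le (gridPoint_lt_one hN _).le
  rw [← sub_le_iff_le_add]
  refine le_trans ?_ (le_ciSup hbdd ⟨_, hμ⟩)
  refine le_ciInf fun l => le_stdSimplex_dotProduct l fun i => ?_
  obtain ⟨τ, hτ⟩ := exists_rejectProb_eq hnn (gridPoint_pos hN i) (gridPoint_lt_one hN i)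
  rw [sub_le_iff_le_add]
  refine (ciInf_le (bddBelow_regret m hF) τ).trans ?_
  rw [regret_eq_of_mem_distUnitInterval m hF, hτ]
  have hmat : (matrixA (m + 1) N *ᵥ
      fun j => ∫ s, (r ⁻¹' {j}).indicator (fun _ => (1 : ℝ)) s ∂κ) i
      = ∫ s, kernelA (m + 1) (gridPoint N i) (gridPoint N (r s)) ∂κ := by
    have := hgroup fun j => kernelA (m + 1) (gridPoint N i) (gridPoint N j)
    simp only [mul_one] at this
    exact this
  change _ ≤ (matrixA (m + 1) N *ᵥ
      fun j => ∫ s, (r ⁻¹' {j}).indicator (fun _ => (1 : ℝ)) s ∂κ) i + _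
  rw [hmat]
  have hi2 : Integrable (fun s => kernelA (m + 1) (gridPoint N i) (gridPoint N (r s))) κ := by
    refine (integrable_const (1 : ℝ)).mono' ((measurable_of_countable
      (fun j => kernelA (m + 1) (gridPoint N i) (gridPoint N j))).comp hrm).aestronglyMeasurable
      (Filter.Eventually.of_forall fun s => ?_)
    rw [Real.norm_of_nonneg (kernelA_nonneg m (gridPoint_pos hN _).le (gridPoint_pos hN _).le
      (gridPoint_lt_one hN _).le)]
    exact kernelA_le_one m (gridPoint_pos hN _).le (gridPoint_lt_one hN _).le
      (gridPoint_pos hN _).le (gridPoint_lt_one hN _).le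
  calc _ ≤ ∫ s, (kernelA (m + 1) (gridPoint N i) (gridPoint N (r s)) + m / (2 * N)) ∂κ := by
        refine integral_mono ((integrableOn_kernelA m hnn hi (gridPoint_pos hN i).le
          (gridPoint_lt_one hN i).le).mono_set Set.Ioc_subset_Ioi_self)
          (hi2.add (integrable_const _)) fun s => ?_
        exact kernelA_le_grid_right m hm hN (cdf_nonneg _ s) (cdf_le_one _ s) i
    _ = _ := by
        rw [integral_add hi2 (integrable_const _)]
        simp [hκ]

/-! ### The ratio game against its matrix -/

lemma worstCaseRatio_le (m : ℕ) (hN : 2 ≤ N) :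
    worstCaseRatio (m + 1) distNonneg ≤ matrixValueR (m + 1) N + m / N := by
  have := nonempty_stdSimplex_grid hN
  rw [← sub_le_iff_le_add, matrixValueR]
  refine le_ciInf fun μ => ?_
  rw [sub_le_iff_le_add]
  have hD : ∀ j : Fin (N - 1), 0 < 1 - gridPoint N j ^ (m + 1) := fun j =>
    sub_pos.2 (pow_lt_one₀ (gridPoint_pos hN j).le (gridPoint_lt_one hN j) (by simp))
  -- This weighting makes μ_j the contribution of height j/N to the prophet's value, which is
  -- thereby normalized to 1.
  set v : Fin (N - 1) → ℝ := fun j => (μ : Fin (N - 1) → ℝ) j / (1 - gridPoint N j ^ (m + 1))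
    with hv
  have hv0 : ∀ j, 0 ≤ v j := fun j => div_nonneg (μ.2.1 j) (hD j).le
  obtain ⟨F, hF, hi, hint⟩ := exists_law_integral_comp_cdf hN hv0
  have hnn : ∀ᵐ x ∂(F : Measure ℝ), 0 ≤ x := hF.mono fun x hx => hx.1
  have hM : prophetValue (m + 1) F = 1 := by
    rw [prophetValue_eq m hnn hi, hint (fun y => 1 - y ^ (m + 1)) (by simp)]
    refine Eq.trans ?_ (stdSimplex.sum_eq_one μ)
    exact Finset.sum_congr rfl fun j _ => div_mul_cancel₀ _ (hD j).ne'
  have hmem : F ∈ distNonneg := by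
    refine ⟨hnn, hi, fun h => ?_⟩
    rw [prophetValue_eq_zero m h hi] at hM
    exact zero_ne_one hM
  have hbdd : BddBelow (Set.range fun F : distNonneg =>
      ⨆ τ : ThresholdRule, competitiveRatio (m + 1) τ F) := by
    refine ⟨0, ?_⟩
    rintro _ ⟨G, rfl⟩
    exact Real.iSup_nonneg fun τ => competitiveRatio_nonneg m G.2 τ
  refine (ciInf_le hbdd ⟨F, hmem⟩).trans (ciSup_le fun τ => ?_)
  obtain ⟨i, hle⟩ := rewardKernel_le_grid_left (m := m) hN (rejectProb_nonneg τ F)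
  simp only
  rw [competitiveRatio, hM, div_one, reward_eq m hnn hi,
    hint _ (by simp [rewardKernel, rejectProb_le_one τ F])]
  refine le_trans ?_ (add_le_add_left (apply_le_iSup_dotProduct _ i) _)
  calc _ ≤ ∑ j, v j * (rewardKernel (m + 1) (gridPoint N i) (gridPoint N j)
          + m / N * (1 - gridPoint N j ^ (m + 1))) :=
        Finset.sum_le_sum fun j _ => mul_le_mul_of_nonneg_left (hle j) (hv0 j)
    _ = ∑ j, (kernelR (m + 1) (gridPoint N i) (gridPoint N j) * (μ : Fin (N - 1) → ℝ) j
          + (μ : Fin (N - 1) → ℝ) j * (m / N)) := by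
        refine Finset.sum_congr rfl fun j _ => ?_
        rw [kernelR_eq m (gridPoint_lt_one hN i) (gridPoint_pos hN j).le (gridPoint_lt_one hN j)]
        have := (hD j).ne'
        simp only [hv]
        field_simp
    _ = _ := by
        rw [Finset.sum_add_distrib, ← Finset.sum_mul, stdSimplex.sum_eq_one, one_mul]
        rfl

lemma kernelR_grid_nonneg (m : ℕ) (hN : 2 ≤ N) (i j : Fin (N - 1)) :
    0 ≤ kernelR (m + 1) (gridPoint N i) (gridPoint N j) := by
  rw [kernelR_eq m (gridPoint_lt_one hN i) (gridPoint_pos hN j).le (gridPoint_lt_one hN j)]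
  exact div_nonneg (rewardKernel_nonneg _ (gridPoint_pos hN i).le (gridPoint_lt_one hN i).le
    (gridPoint_lt_one hN j).le)
    (sub_nonneg.2 (pow_le_one₀ (gridPoint_pos hN j).le (gridPoint_lt_one hN j).le))

/-- Nature's matrix strategy gives j/N the share of the prophet's value that comes from levels s
whose F(s) is rounded to j/N. -/
lemma matrixValueR_le (m : ℕ) (hm : 1 ≤ m) (hN : 2 ≤ N) (hne : Nonempty distNonneg) :
    matrixValueR (m + 1) N ≤ worstCaseRatio (m + 1) distNonneg + m / N := by
  have hsimplex := nonempty_stdSimplex_grid hN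
  rw [← sub_le_iff_le_add, worstCaseRatio]
  refine le_ciInf fun ⟨F, hF⟩ => ?_
  rw [sub_le_iff_le_add]
  have hnn := hF.1
  have hi := hF.2.1
  have hMpos := prophetValue_pos m hF
  set M := prophetValue (m + 1) F with hM
  set r : ℝ → Fin (N - 1) := fun s => floorIndex N hN (cdf (F : Measure ℝ) s * N) with hr
  have hrm : Measurable r := (measurable_floorIndex N hN).comp
    ((monotone_cdf (F : Measure ℝ)).measurable.mul_const _)
  set κ : Measure ℝ := volume.restrict (Set.Ioi (0 : ℝ)) with hκ
  set D : ℝ → ℝ := fun s => 1 - cdf (F : Measure ℝ) s ^ (m + 1) with hDdef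
  have hD0 : ∀ s, 0 ≤ D s := fun s => sub_nonneg.2 (pow_le_one₀ (cdf_nonneg _ s) (cdf_le_one _ s))
  have hDi : Integrable D κ := integrableOn_one_sub_cdf_pow m hnn hi
  have hMD : M = ∫ s, D s ∂κ := prophetValue_eq m hnn hi
  have hgroup := sum_integral_indicator_mul hrm hDi
  have hμ : (fun j => (∫ s, (r ⁻¹' {j}).indicator D s ∂κ) / M) ∈ stdSimplex ℝ (Fin (N - 1)) := by
    refine ⟨fun j => div_nonneg
      (integral_nonneg fun s => Set.indicator_nonneg (fun s _ => hD0 s) s) hMpos.le, ?_⟩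
    have := hgroup fun _ => 1
    simp only [one_mul] at this
    rw [← Finset.sum_div, this, ← hMD, div_self hMpos.ne']
  have hbdd : BddBelow (Set.range fun μ : stdSimplex ℝ (Fin (N - 1)) =>
      ⨆ l : stdSimplex ℝ (Fin (N - 1)),
        (l : Fin (N - 1) → ℝ) ⬝ᵥ (matrixR (m + 1) N *ᵥ (μ : Fin (N - 1) → ℝ))) := by
    refine ⟨0, ?_⟩
    rintro _ ⟨μ, rfl⟩
    refine le_trans ?_ (apply_le_iSup_dotProduct _ ⟨0, by omega⟩)
    rw [Matrix.mulVec, dotProduct_comm]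
    exact le_stdSimplex_dotProduct μ fun j => kernelR_grid_nonneg m hN _ _
  have hbdd' : BddAbove (Set.range fun τ => competitiveRatio (m + 1) τ F) := by
    refine ⟨1, ?_⟩
    rintro _ ⟨τ, rfl⟩
    exact competitiveRatio_le_one m hF τ
  refine (ciInf_le hbdd ⟨_, hμ⟩).trans ?_
  refine ciSup_le fun l => stdSimplex_dotProduct_le l fun i => ?_
  obtain ⟨τ, hτ⟩ := exists_rejectProb_eq hnn (gridPoint_pos hN i) (gridPoint_lt_one hN i)
  refine le_trans ?_ (add_le_add_left (le_ciSup hbdd' τ) _)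
  have hmat : (matrixR (m + 1) N *ᵥ
      fun j => (∫ s, (r ⁻¹' {j}).indicator D s ∂κ) / M) i
      = (∫ s, kernelR (m + 1) (gridPoint N i) (gridPoint N (r s)) * D s ∂κ) / M := by
    rw [← hgroup fun j => kernelR (m + 1) (gridPoint N i) (gridPoint N j), Finset.sum_div,
      matrixR_mulVec]
    exact Finset.sum_congr rfl fun j _ => (mul_div_assoc _ _ M).symm
  change (matrixR (m + 1) N *ᵥ
      fun j => (∫ s, (r ⁻¹' {j}).indicator D s ∂κ) / M) i ≤ _
  rw [hmat, competitiveRatio, ← hM, reward_eq m hnn hi, hτ, div_le_iff₀ hMpos, add_mul,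
    div_mul_cancel₀ _ hMpos.ne', hMD, ← integral_const_mul, ← integral_add
      (integrableOn_rewardKernel m hnn hi (gridPoint_pos hN i).le (gridPoint_lt_one hN i).le)
      (hDi.const_mul _)]
  refine integral_mono_of_nonneg (Filter.Eventually.of_forall fun s =>
    mul_nonneg (kernelR_grid_nonneg m hN _ _) (hD0 s))
    ((integrableOn_rewardKernel m hnn hi (gridPoint_pos hN i).le (gridPoint_lt_one hN i).le).add
      (hDi.const_mul _)) (Filter.Eventually.of_forall fun s => ?_)
  have := grid_right_le_rewardKernel m hm hN (cdf_nonneg (F : Measure ℝ) s) (cdf_le_one _ s) i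
  simp only [hDdef]
  rw [sub_mul] at this
  linarith

lemma nonempty_distNonneg : Nonempty distNonneg := by
  refine ⟨⟨⟨Measure.dirac 1, inferInstance⟩, ?_, ?_, ?_⟩⟩
  · exact (ae_dirac_iff measurableSet_Ici).2 (zero_le_one (α := ℝ))
  · exact integrable_dirac (by simp)
  · intro h
    exact one_ne_zero ((ae_dirac_iff (measurableSet_singleton (0 : ℝ))).1 h)

/-- The bracket is at most 1/2 because (1 - 1/e)^2 < 1/2, and it is positive because (1 - 1/e)^2 >
1/3 ≥ 1/m. Positivity is where m ≥ 3 enters. -/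
lemma div_le_div_ratio_constant {m : ℕ} (hm : 3 ≤ m) (hN : 2 ≤ N) :
    (m : ℝ) / N ≤ m / (2 * N * ((1 - Real.exp (-1)) ^ 2 - 1 / m)) := by
  have h1 := Real.exp_neg_one_gt_d9
  have h2 := Real.exp_neg_one_lt_d9
  have hm' : (3 : ℝ) ≤ m := by exact_mod_cast hm
  have hN0 : (0 : ℝ) < N := by norm_cast; omega
  have h3 : 1 / (m : ℝ) ≤ 1 / 3 := one_div_le_one_div_of_le (by norm_num) hm'
  have h4 : 0 < 1 / (m : ℝ) := by positivity
  have hc0 : 0 < (1 - Real.exp (-1)) ^ 2 - 1 / (m : ℝ) := by nlinarith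
  have hc1 : (1 - Real.exp (-1)) ^ 2 - 1 / (m : ℝ) ≤ 1 / 2 := by nlinarith
  refine div_le_div_of_nonneg_left (by positivity) (by positivity) ?_
  nlinarith

end

end Prophet

theorem theorem4 (n N : ℕ) (hN : 2 ≤ N) :
    (2 ≤ n →
      |Prophet.worstCaseRegret n Prophet.distUnitInterval - Prophet.matrixValueA n N|
        ≤ ((n : ℝ) - 1) / (2 * (N : ℝ))) ∧
    (4 ≤ n →
      |Prophet.worstCaseRatio n Prophet.distNonneg - Prophet.matrixValueR n N|
        ≤ ((n : ℝ) - 1) /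
          (2 * (N : ℝ) * ((1 - Real.exp (-1)) ^ 2 - 1 / ((n : ℝ) - 1)))) := by
  rcases n with _ | m
  · simp
  rw [Nat.cast_succ, add_sub_cancel_right]
  constructor
  · intro hn
    have h1 := Prophet.matrixValueA_sub_le m hN
    have h2 := Prophet.worstCaseRegret_le m (by omega) hN
    rw [abs_le]
    constructor <;> linarith
  · intro hn
    have h1 := Prophet.worstCaseRatio_le m hN
    have h2 := Prophet.matrixValueR_le m (by omega) hN Prophet.nonempty_distNonneg
    have h3 := Prophet.div_le_div_ratio_constant (m := m) (by omega) hN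
    rw [abs_le]
    constructor <;> linarith
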